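/- For an integer $n\ge 1$ let $G_n(t,s)$ be Green's function of the operator $(-1)^n\frac{d^{2n}}{dt^{2n}}$ on $(-1,1)$ with boundary conditions $\psi(\pm1)=\psi'(\pm1)=\cdots=\psi^{(n-1)}(\pm1)=0$. That is, for each $s\in(-1,1)$ the function $G_n(\cdot,s)$ is $C^{2n-2}$ on $[-1,1]$, is smooth and satisfies $(-1)^n\partial_t^{2n}G_n(t,s)=0$ on each of $[-1,s]$ and $[s,1]$, satisfies the boundary conditions, and its $(2n-1)$-st derivative jumps by $(-1)^n$ at $s$. Let $$(T_nf)(t)=\int_{-1}^1G_n(t,s)f(s)\,ds$$ be the solution operator, acting on (real- or complex-valued) functions in $L^p(-1,1)$, $1\le p\le\infty$, and let $\|T_n\|_{p,p}$ be its operator norm on $L^p(-1,1)$. Put $$a_n=\sqrt2\,(2n)!\,\frac{\Gamma(n+\frac12)}{2\,\Gamma(n+1)\,\Gamma(2n+\frac12)},\qquad R_n={}_3F_2\!\left(\tfrac12,1,-n;1-2n,n+1;1\right)=\sum_{k=0}^n\frac{(1/2)_k(1)_k(-n)_k}{(1-2n)_k(n+1)_k\,k!},\qquad b_n=R_na_n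 .$$ Then: 1. $T_n$ maps $L^p(-1,1)$ into itself for all $n\ge1$ and $p\in[1,\infty]$. 2. $\|T_n\|_{\infty,\infty}=\|T_n\|_{1,1}=\dfrac1{(2n)!}$ for all $n\ge1$. 3. $a_n\to1$ and $b_n\to1$ as $n\to\infty$, and for all $n\ge1$ and all $p,q\in[1,\infty]$ with $\frac1p+\frac1q=1$, writing $r=\max(p,q)$ (and $\frac1\infty=\frac2\infty=0$), $$\frac{a_n}{\sqrt2\,(2n)!}\le\|T_n\|_{p,p}\le\frac{b_n^{2/r}}{(2n)!\,2^{1/r}} .$$ 4. Hence $\|T_n\|_{p,p}\asymp\frac1{(2n)!}$ uniformly in $p$: there are constants $c,C>0$ such that $\frac{c}{(2n)!}\le\|T_n\|_{p,p}\le\frac{C}{(2n)!}$ for all $n\ge1$ and $p\in[1,\infty]$. 5. For every $n\ge1$ and every $h\in\mathscr D(-1,1)$ (smooth, with compact support contained in $(-1,1)$) with $\int_{-1}^1|h|=1$, one has $\|h^{(2n)}\|_1\ge(2n)!$. -/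

import Mathlib

open MeasureTheory Set
open scoped ENNReal Nat

/-- `G` is a Green's function of the operator `(-1)^n d^{2n}/dt^{2n}` on `(-1,1)` with the boundary
conditions `ψ(±1) = ψ'(±1) = ⋯ = ψ^{(n-1)}(±1) = 0` (for `1 ≤ n`): for every source point
`s ∈ (-1,1)` the function `G(·,s)` is `C^{2n-2}` on `[-1,1]`, is smooth and solves the homogeneous
equation on either side of `s`, satisfies the boundary conditions, and its derivative of order
`2n-1` jumps by `(-1)^n` at `s`. -/
structure IsGreenFunction (n : ℕ) (G : ℝ → ℝ → ℝ) : Prop where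
  contDiffOn : ∀ s ∈ Ioo (-1 : ℝ) 1,
    ContDiffOn ℝ ((2 * n - 2 : ℕ) : ℕ∞) (fun t => G t s) (Icc (-1) 1)
  contDiffOn_left : ∀ s ∈ Ioo (-1 : ℝ) 1,
    ContDiffOn ℝ (⊤ : ℕ∞) (fun t => G t s) (Icc (-1) s)
  contDiffOn_right : ∀ s ∈ Ioo (-1 : ℝ) 1,
    ContDiffOn ℝ (⊤ : ℕ∞) (fun t => G t s) (Icc s 1)
  eqn_left : ∀ s ∈ Ioo (-1 : ℝ) 1, ∀ t ∈ Icc (-1) s,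
    (-1 : ℝ) ^ n * iteratedDerivWithin (2 * n) (fun t => G t s) (Icc (-1) s) t = 0
  eqn_right : ∀ s ∈ Ioo (-1 : ℝ) 1, ∀ t ∈ Icc s 1,
    (-1 : ℝ) ^ n * iteratedDerivWithin (2 * n) (fun t => G t s) (Icc s 1) t = 0
  bdry_left : ∀ s ∈ Ioo (-1 : ℝ) 1, ∀ j < n,
    iteratedDerivWithin j (fun t => G t s) (Icc (-1) s) (-1) = 0
  bdry_right : ∀ s ∈ Ioo (-1 : ℝ) 1, ∀ j < n,
    iteratedDerivWithin j (fun t => G t s) (Icc s 1) 1 = 0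
  jump : ∀ s ∈ Ioo (-1 : ℝ) 1,
    iteratedDerivWithin (2 * n - 1) (fun t => G t s) (Icc s 1) s
      - iteratedDerivWithin (2 * n - 1) (fun t => G t s) (Icc (-1) s) s = (-1) ^ n

theorem contDiff_max_zero_pow (m : ℕ) :
    ContDiff ℝ (m : ℕ∞) (fun x : ℝ => (max x 0) ^ (m + 1)) := by
  have hd : ∀ (k : ℕ) (x : ℝ), HasDerivAt (fun x : ℝ => (max x 0) ^ (k + 2))
      ((k + 2 : ℝ) * (max x 0) ^ (k + 1)) x := by
    intro k x
    rcases lt_trichotomy x 0 with h | h | h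
    · have : HasDerivAt (fun _ : ℝ => (0 : ℝ)) 0 x := hasDerivAt_const x 0
      rw [max_eq_right h.le]
      simp only [ne_eq, Nat.add_eq_zero_iff, one_ne_zero, and_false, not_false_eq_true, zero_pow,
        mul_zero]
      refine this.congr_of_eventuallyEq ?_
      filter_upwards [Iio_mem_nhds h] with y hy
      rw [max_eq_right (le_of_lt hy)]; simp
    · subst h
      simp only [max_self, ne_eq, Nat.add_eq_zero_iff, one_ne_zero, and_false, not_false_eq_true,
        zero_pow, mul_zero]
      rw [hasDerivAt_iff_isLittleO]
      simp only [max_self, sub_zero, smul_zero]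
      have h1 : (fun x : ℝ => (max x 0) ^ (k + 2) - 0 ^ (k + 2)) =O[nhds 0]
          (fun x : ℝ => x ^ (k + 2)) := by
        refine Asymptotics.IsBigO.of_bound 1 (Filter.Eventually.of_forall fun y => ?_)
        simp only [ne_eq, Nat.add_eq_zero_iff, OfNat.ofNat_ne_zero, and_false, not_false_eq_true,
          zero_pow, sub_zero, norm_pow, Real.norm_eq_abs, one_mul]
        refine pow_le_pow_left₀ (abs_nonneg _) ?_ _
        rw [abs_of_nonneg (le_max_right y 0)]
        exact max_le (le_abs_self y) (abs_nonneg y)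
      exact h1.trans_isLittleO (Asymptotics.isLittleO_pow_id (by omega))
    · have := hasDerivAt_pow (k + 2) x
      rw [max_eq_left h.le]
      have h2 : HasDerivAt (fun x : ℝ => x ^ (k + 2)) ((k + 2 : ℝ) * x ^ (k + 1)) x := by
        simpa using this
      refine h2.congr_of_eventuallyEq ?_
      filter_upwards [Ioi_mem_nhds h] with y hy
      rw [max_eq_left (le_of_lt hy)]
  induction m with
  | zero => simp only [Nat.cast_zero, zero_add, pow_one]; exact contDiff_zero.2 (by fun_prop)
  | succ k ih =>
    have : (((k + 1 : ℕ) : ℕ∞) : WithTop ℕ∞) = ((k : ℕ∞) : WithTop ℕ∞) + 1 := by push_cast; rfl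
    rw [this, contDiff_succ_iff_deriv]
    refine ⟨fun x => (hd k x).differentiableAt, by simp, ?_⟩
    have h3 : deriv (fun x : ℝ => (max x 0) ^ (k + 1 + 1))
        = fun x => (k + 2 : ℝ) * (max x 0) ^ (k + 1) := funext fun x => (hd k x).deriv
    rw [h3]
    exact contDiff_const.mul ih

theorem contDiff_polynomial_eval {m : WithTop ℕ∞} (P : Polynomial ℝ) :
    ContDiff ℝ m (fun x : ℝ => P.eval x) := by
  have := P.contDiff_aeval (𝕜 := ℝ) (R := ℝ) m
  simpa using this

theorem iteratedDerivWithin_polynomial (P : Polynomial ℝ) {a b : ℝ} (hab : a < b) (k : ℕ) {t : ℝ}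
    (ht : t ∈ Icc a b) {g : ℝ → ℝ} (hg : ∀ x ∈ Icc a b, g x = P.eval x) :
    iteratedDerivWithin k g (Icc a b) t = (Polynomial.derivative^[k] P).eval t := by
  rw [iteratedDerivWithin_congr (g := fun x => P.eval x) (fun x hx => hg x hx) ht,
    iteratedDerivWithin_eq_iteratedDeriv (uniqueDiffOn_Icc hab) (contDiff_polynomial_eval P).contDiffAt ht]
  rw [iteratedDeriv_eq_iterate]
  have : ∀ (k : ℕ) (Q : Polynomial ℝ), deriv^[k] (fun x => Q.eval x)
      = fun x => (Polynomial.derivative^[k] Q).eval x := by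
    intro k
    induction k with
    | zero => intro Q; rfl
    | succ k ih =>
      intro Q
      rw [Function.iterate_succ_apply, Function.iterate_succ_apply, ← ih]
      congr 1
      funext x
      exact Q.deriv
  rw [this]

theorem exists_greenPolynomials (n : ℕ) (hn : 1 ≤ n) (s : ℝ) : ∃ L R : Polynomial ℝ,
    L.degree < (2 * n : ℕ) ∧ R.degree < (2 * n : ℕ) ∧
    (Polynomial.X - Polynomial.C (-1)) ^ n ∣ L ∧ (Polynomial.X - Polynomial.C 1) ^ n ∣ R ∧
    R = L + Polynomial.C ((-1) ^ n / ((2 * n - 1)! : ℝ))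
      * (Polynomial.X - Polynomial.C s) ^ (2 * n - 1) := by
  open Polynomial in
  set c : ℝ := (-1) ^ n / ((2 * n - 1)! : ℝ)
  set F : ℝ[X] := C c * (X - C s) ^ (2 * n - 1)
  have hFd : F.degree < (2 * n : ℕ) := by
    refine lt_of_le_of_lt (degree_mul_le _ _) (lt_of_le_of_lt (add_le_add_left degree_C_le _) ?_)
    rw [zero_add, degree_pow, degree_X_sub_C]
    simp only [nsmul_eq_mul, mul_one]
    exact_mod_cast (by omega : 2 * n - 1 < 2 * n)
  have hcop : IsCoprime ((X - C (-1 : ℝ)) ^ n) ((X - C (1 : ℝ)) ^ n) :=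
    (isCoprime_X_sub_C_of_isUnit_sub (by norm_num)).pow
  obtain ⟨u, v, huv⟩ := hcop
  set p : ℝ[X] := (X - C (-1 : ℝ)) ^ n with hp
  set q : ℝ[X] := (X - C (1 : ℝ)) ^ n with hq
  have hpm : p.Monic := (monic_X_sub_C _).pow n
  have hqm : q.Monic := (monic_X_sub_C _).pow n
  have hpd : p.degree = n := by rw [hp, degree_pow, degree_X_sub_C]; simp
  have hqd : q.degree = n := by rw [hq, degree_pow, degree_X_sub_C]; simp
  set A : ℝ[X] := (F * v) %ₘ p
  have hA : A + p * ((F * v) /ₘ p) = F * v := modByMonic_add_div _ p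
  have hAd : A.degree < n := hpd ▸ degree_modByMonic_lt _ hpm
  have hRd : (A * q).degree < (2 * n : ℕ) := by
    rw [degree_mul, hqd]
    have h2 : ((2 * n : ℕ) : WithBot ℕ) = (n : WithBot ℕ) + (n : WithBot ℕ) := by
      rw [two_mul]; push_cast; rfl
    rw [h2]
    exact WithBot.add_lt_add_right (WithBot.coe_ne_bot) hAd
  refine ⟨A * q - F, A * q, ?_, hRd, ?_, dvd_mul_left _ _, by ring⟩
  · exact lt_of_le_of_lt (degree_sub_le _ _) (max_lt hRd hFd)
  · refine ⟨-(((F * v) /ₘ p) * q) - F * u, ?_⟩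
    linear_combination q * hA + F * huv

theorem exists_isGreenFunction (n : ℕ) (hn : 1 ≤ n) : ∃ G, IsGreenFunction n G := by
  choose L R hL hR hpL hpR hLR using exists_greenPolynomials n hn
  set G : ℝ → ℝ → ℝ := fun t s => if t ≤ s then (L s).eval t else (R s).eval t with hG
  have hGl : ∀ s a, ∀ t ∈ Icc a s, G t s = (L s).eval t := fun s a t ht => by
    simp [hG, ht.2]
  have hGr : ∀ s b, ∀ t ∈ Icc s b, G t s = (R s).eval t := fun s b t ht => by
    rcases ht.1.eq_or_lt with h | h
    · subst h
      have : 2 * n - 1 ≠ 0 := by omega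
      simp [hG, hLR, this]
    · simp [hG, not_le.2 h]
  have hz : ∀ (P : Polynomial ℝ), P.degree < (2 * n : ℕ) →
      Polynomial.derivative^[2 * n] P = 0 := fun P hP =>
    Polynomial.iterate_derivative_eq_zero_of_degree_lt hP
  have hb : ∀ (P : Polynomial ℝ) (x : ℝ), (Polynomial.X - Polynomial.C x) ^ n ∣ P →
      ∀ j < n, (Polynomial.derivative^[j] P).eval x = 0 := by
    intro P x hP j hj
    have h1 := Polynomial.pow_sub_dvd_iterate_derivative_of_pow_dvd j hP
    exact Polynomial.dvd_iff_isRoot.1 ((dvd_pow_self _ (by omega)).trans h1)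
  refine ⟨G, ?_, ?_, ?_, ?_, ?_, ?_, ?_, ?_⟩
  · intro s hs
    have h1 : (fun t => G t s) = fun t => (L s).eval t
        + ((-1) ^ n / ((2 * n - 1)! : ℝ)) * (max (t - s) 0) ^ (2 * n - 2 + 1) := by
      have h21 : 2 * n - 2 + 1 = 2 * n - 1 := by omega
      have h0 : 2 * n - 1 ≠ 0 := by omega
      funext t
      rw [h21]
      by_cases h : t ≤ s
      · simp [hG, h, h0]
      · simp [hG, h, hLR, max_eq_left (sub_nonneg.2 (le_of_not_ge h))]
    rw [h1]
    refine ContDiff.contDiffOn ((contDiff_polynomial_eval (L s)).add (contDiff_const.mul ?_))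
    exact (contDiff_max_zero_pow (2 * n - 2)).comp (contDiff_id.sub contDiff_const)
  · intro s hs
    exact ((contDiff_polynomial_eval (L s)).contDiffOn).congr (hGl s (-1))
  · intro s hs
    exact ((contDiff_polynomial_eval (R s)).contDiffOn).congr (hGr s 1)
  · intro s hs t ht
    rw [iteratedDerivWithin_polynomial (L s) hs.1 _ ht (hGl s (-1)), hz _ (hL s)]; simp
  · intro s hs t ht
    rw [iteratedDerivWithin_polynomial (R s) hs.2 _ ht (hGr s 1), hz _ (hR s)]; simp
  · intro s hs j hj
    rw [iteratedDerivWithin_polynomial (L s) hs.1 _ (left_mem_Icc.2 hs.1.le) (hGl s (-1))]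
    exact hb _ _ (hpL s) j hj
  · intro s hs j hj
    rw [iteratedDerivWithin_polynomial (R s) hs.2 _ (right_mem_Icc.2 hs.2.le) (hGr s 1)]
    exact hb _ _ (hpR s) j hj
  · intro s hs
    rw [iteratedDerivWithin_polynomial (R s) hs.2 _ (left_mem_Icc.2 hs.2.le) (hGr s 1),
      iteratedDerivWithin_polynomial (L s) hs.1 _ (right_mem_Icc.2 hs.1.le) (hGl s (-1)), hLR s,
      iterate_map_add, Polynomial.eval_add, add_sub_cancel_left,
      Polynomial.iterate_derivative_C_mul, Polynomial.iterate_derivative_X_sub_pow_self]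
    have : ((2 * n - 1)! : ℝ) ≠ 0 := by positivity
    simp [this]

/-- The Green's function `G_n` (for `1 ≤ n`; its existence is `exists_isGreenFunction`, and the
defining conditions determine it on `[-1,1] × (-1,1)`). -/
noncomputable def greenFunction (n : ℕ) : ℝ → ℝ → ℝ :=
  Classical.epsilon (IsGreenFunction n)

theorem isGreenFunction_greenFunction (n : ℕ) (hn : 1 ≤ n) :
    IsGreenFunction n (greenFunction n) :=
  Classical.epsilon_spec (exists_isGreenFunction n hn)

/-- Lebesgue measure on the interval `(-1,1)`. -/
noncomputable def intervalMeasure : Measure ℝ := volume.restrict (Ioo (-1) 1)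

/-- The solution operator `(T_n f)(t) = ∫_{-1}^1 G_n(t,s) f(s) ds`. -/
noncomputable def solutionOperator {𝕜 : Type*} [RCLike 𝕜] (n : ℕ) (f : ℝ → 𝕜) : ℝ → 𝕜 :=
  fun t => ∫ s, (greenFunction n t s : 𝕜) * f s ∂intervalMeasure

/-- The operator norm `‖T_n‖_{p,p}` of `T_n` acting on `L^p(-1,1)` (with values in `𝕜`), as the
supremum of `‖T_n f‖_p` over the closed unit ball of `L^p(-1,1)`. -/
noncomputable def solutionOpNorm (𝕜 : Type*) [RCLike 𝕜] (n : ℕ) (p : ℝ≥0∞) : ℝ≥0∞ :=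
  ⨆ (f : ℝ → 𝕜) (_ : MemLp f p intervalMeasure) (_ : eLpNorm f p intervalMeasure ≤ 1),
    eLpNorm (solutionOperator n f) p intervalMeasure

/-- `a_n = √2 (2n)! α_n`, where `α_n = Γ(n+1/2) / (2 Γ(n+1) Γ(2n+1/2))`. -/
noncomputable def lowerFactor (n : ℕ) : ℝ :=
  √2 * (2 * n)! * (Real.Gamma (n + 1 / 2) / (2 * Real.Gamma (n + 1) * Real.Gamma (2 * n + 1 / 2)))

/-- `R_n = ₃F₂(1/2, 1, -n; 1-2n, n+1; 1)`, a series that terminates at `k = n`. -/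
noncomputable def hypergeometricRatio (n : ℕ) : ℝ :=
  ∑ k ∈ Finset.range (n + 1),
    (ascPochhammer ℝ k).eval (1 / 2) * (ascPochhammer ℝ k).eval 1 *
        (ascPochhammer ℝ k).eval (-n : ℝ) /
      ((ascPochhammer ℝ k).eval (1 - 2 * n : ℝ) * (ascPochhammer ℝ k).eval (n + 1 : ℝ) * k !)

/-- `b_n = R_n a_n`. -/
noncomputable def upperFactor (n : ℕ) : ℝ :=
  hypergeometricRatio n * lowerFactor n

/-- `h ∈ 𝒟(-1,1)`: smooth with compact support contained in the open interval `(-1,1)`. -/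
def IsTestFunction {𝕜 : Type*} [RCLike 𝕜] (h : ℝ → 𝕜) : Prop :=
  ContDiff ℝ (⊤ : ℕ∞) h ∧ HasCompactSupport h ∧ tsupport h ⊆ Ioo (-1) 1

/-!
The Green's function is Boggio's kernel, which is nonnegative and symmetric. Hence `T_n` maps `1` to
`(1 - t²)ⁿ / (2n)!`, and its norms on `L^1` and `L^∞` are the supremum `1 / (2n)!` of this function.

For the weight `w t = (1 - t²)ⁿ` the `2n`-th derivatives of the functions `(1 - t²)^(n + k)`,
`k ≤ n`, give `T_n w = α_n ∑ c_k (1 - t²)^(n + k)`, where `c_k > 0`, `c_0 = 1` and `∑ c_k = R_n`.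
Therefore `α_n w ≤ T_n w ≤ R_n α_n w` pointwise. The first inequality bounds every `‖T_n‖_{p,p}`
below by `α_n`. The second one, interpolated with `T_n 1 ≤ 1 / (2n)!`, is what Schur's test with a
power of `w` needs to give the upper bound. The last assertion is the `L^1` bound for
`T_n h^{(2n)} = (-1)^n h`.
-/

section PiecewisePolynomials

open Polynomial

theorem X_sub_C_pow_dvd_iff_iterate_derivative_eval_eq_zero {R : Type*} [CommRing R]
    [NoZeroDivisors R] [CharZero R] {P : R[X]} {x : R} {n : ℕ} :
    (X - C x) ^ n ∣ P ↔ ∀ j < n, (derivative^[j] P).eval x = 0 := by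
  rcases eq_or_ne P 0 with rfl | hP
  · simp
  cases n with
  | zero => simp
  | succ n =>
    rw [← le_rootMultiplicity_iff hP, Nat.succ_le_iff,
      lt_rootMultiplicity_iff_isRoot_iterate_derivative hP]
    simp only [Nat.lt_succ_iff, IsRoot]

theorem degree_C_mul_X_sub_C_pow_lt {R : Type*} [CommRing R] (c x : R) (m : ℕ) :
    degree (C c * (X - C x) ^ m) < (m + 1 : ℕ) :=
  degree_le_natDegree.trans_lt <| Nat.cast_lt.2 <| Nat.lt_succ_of_le <|
    (natDegree_C_mul_le _ _).trans <|
      (natDegree_pow_le_of_le m (natDegree_X_sub_C_le x)).trans_eq (mul_one m)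

theorem eq_C_mul_X_sub_C_pow_of_iterate_derivative_eval {K : Type*} [Field K] [CharZero K]
    {P : K[X]} {x c : K} {m : ℕ} (hdeg : P.degree < (m + 1 : ℕ))
    (hzero : ∀ j < m, (derivative^[j] P).eval x = 0) (hc : (derivative^[m] P).eval x = c) :
    P = C (c / (m ! : K)) * (X - C x) ^ m := by
  have hm : (m ! : K) ≠ 0 := Nat.cast_ne_zero.2 m.factorial_ne_zero
  have hdvd : (X - C x) ^ (m + 1) ∣ P - C (c / (m ! : K)) * (X - C x) ^ m := by
    refine X_sub_C_pow_dvd_iff_iterate_derivative_eval_eq_zero.2 fun j hj => ?_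
    rw [iterate_derivative_sub, eval_sub]
    rcases Nat.lt_succ_iff_lt_or_eq.1 hj with hj | rfl
    · rw [hzero j hj,
        X_sub_C_pow_dvd_iff_iterate_derivative_eval_eq_zero.1 (dvd_mul_left _ _) j hj, sub_zero]
    · rw [hc, iterate_derivative_C_mul, iterate_derivative_X_sub_pow_self]
      simp [hm]
  refine sub_eq_zero.1 (eq_zero_of_dvd_of_degree_lt hdvd ?_)
  rw [degree_pow, degree_X_sub_C, nsmul_one]
  refine (degree_sub_le _ _).trans_lt (max_lt hdeg ?_)
  exact degree_C_mul_X_sub_C_pow_lt _ _ _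

theorem exists_polynomial_of_iteratedDerivWithin_eq_zero {f : ℝ → ℝ} {a b : ℝ} (hab : a ≤ b)
    {m : ℕ} (hf : ContDiffOn ℝ m f (Icc a b))
    (h0 : ∀ t ∈ Icc a b, iteratedDerivWithin m f (Icc a b) t = 0) :
    ∃ P : ℝ[X], P.degree < m ∧ ∀ t ∈ Icc a b, f t = P.eval t := by
  cases m with
  | zero => exact ⟨0, by simp, by simpa using h0⟩
  | succ m =>
    refine ⟨∑ k ∈ Finset.range (m + 1),
      C ((k ! : ℝ)⁻¹ * iteratedDerivWithin k f (Icc a b) a) * (X - C a) ^ k, ?_, fun t ht => ?_⟩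
    · rw [← mem_degreeLT]
      refine Submodule.sum_mem _ fun k hk => mem_degreeLT.2 ?_
      exact (degree_C_mul_X_sub_C_pow_lt _ _ _).trans_le
        (by exact_mod_cast Finset.mem_range.1 hk)
    · have htaylor := taylor_mean_remainder_bound (n := m) (C := 0) hab
        (by exact_mod_cast hf) ht (fun y hy => by rw [h0 y hy, norm_zero])
      rw [zero_mul, zero_div, norm_le_zero_iff, sub_eq_zero] at htaylor
      rw [htaylor, taylor_within_apply, eval_finsetSum]
      refine Finset.sum_congr rfl fun k _ => ?_
      simp only [smul_eq_mul, eval_mul, eval_C, eval_pow, eval_sub, eval_X]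
      ring

theorem iteratedDerivWithin_of_subset {𝕜 F : Type*} [NontriviallyNormedField 𝕜]
    [NormedAddCommGroup F] [NormedSpace 𝕜 F] {f : 𝕜 → F} {s t : Set 𝕜} {x : 𝕜} {k : ℕ}
    (hst : s ⊆ t) (hs : UniqueDiffOn 𝕜 s) (ht : UniqueDiffOn 𝕜 t) (hf : ContDiffOn 𝕜 k f t)
    (hx : x ∈ s) :
    iteratedDerivWithin k f s x = iteratedDerivWithin k f t x := by
  simp only [iteratedDerivWithin, iteratedFDerivWithin_subset hst hs ht hf hx]

/-- The polynomials `L` and `R` with which a Green's function `G_n(·, s)` agrees on `[-1, s]` and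
on `[s, 1]`. That the derivatives of order `< 2n - 1` match at `s` while the one of order `2n - 1`
jumps by `(-1)^n` is encoded in the value of `R - L`. -/
structure IsGreenPair (n : ℕ) (s : ℝ) (L R : ℝ[X]) : Prop where
  degree_left : L.degree < (2 * n : ℕ)
  degree_right : R.degree < (2 * n : ℕ)
  dvd_left : (X - C (-1)) ^ n ∣ L
  dvd_right : (X - C 1) ^ n ∣ R
  jump : R - L = C ((-1) ^ n / ((2 * n - 1)! : ℝ)) * (X - C s) ^ (2 * n - 1)

theorem IsGreenPair.unique {n : ℕ} {s : ℝ} {L R L' R' : ℝ[X]} (h : IsGreenPair n s L R)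
    (h' : IsGreenPair n s L' R') : L = L' ∧ R = R' := by
  have hdiff : R - R' = L - L' := by linear_combination h.jump - h'.jump
  have hdvd : (X - C (-1 : ℝ)) ^ n * (X - C 1) ^ n ∣ L - L' :=
    (isCoprime_X_sub_C_of_isUnit_sub (by norm_num)).pow.mul_dvd (dvd_sub h.dvd_left h'.dvd_left)
      (hdiff ▸ dvd_sub h.dvd_right h'.dvd_right)
  have hdeg : (L - L').degree < ((X - C (-1 : ℝ)) ^ n * (X - C 1) ^ n).degree := by
    refine (degree_sub_le _ _).trans_lt ((max_lt h.degree_left h'.degree_left).trans_eq ?_)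
    rw [degree_mul, degree_pow, degree_pow, degree_X_sub_C, degree_X_sub_C, two_mul]
    simp
  have hzero : L - L' = 0 := eq_zero_of_dvd_of_degree_lt hdvd hdeg
  exact ⟨sub_eq_zero.1 hzero, sub_eq_zero.1 (hdiff.trans hzero)⟩

theorem IsGreenFunction.sub_eq_of_eqOn {n : ℕ} (hn : 1 ≤ n) {G : ℝ → ℝ → ℝ}
    (hG : IsGreenFunction n G) {s : ℝ} (hs : s ∈ Ioo (-1 : ℝ) 1) {L R : ℝ[X]}
    (hLdeg : L.degree < (2 * n : ℕ)) (hRdeg : R.degree < (2 * n : ℕ))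
    (hL : ∀ t ∈ Icc (-1) s, G t s = L.eval t) (hR : ∀ t ∈ Icc s 1, G t s = R.eval t) :
    R - L = C ((-1) ^ n / ((2 * n - 1)! : ℝ)) * (X - C s) ^ (2 * n - 1) := by
  have hsL : s ∈ Icc (-1) s := right_mem_Icc.2 hs.1.le
  have hsR : s ∈ Icc s 1 := left_mem_Icc.2 hs.2.le
  refine eq_C_mul_X_sub_C_pow_of_iterate_derivative_eval ?_ (fun j hj => ?_) ?_
  · rw [Nat.sub_add_cancel (by omega)]
    exact (degree_sub_le _ _).trans_lt (max_lt hRdeg hLdeg)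
  · have hsmooth : ContDiffOn ℝ j (fun t => G t s) (Icc (-1) 1) :=
      (hG.contDiffOn s hs).of_le (by exact_mod_cast (by omega : j ≤ 2 * n - 2))
    have hIcc : UniqueDiffOn ℝ (Icc (-1 : ℝ) 1) := uniqueDiffOn_Icc (by norm_num)
    rw [iterate_derivative_sub, eval_sub, ← iteratedDerivWithin_polynomial L hs.1 j hsL hL,
      ← iteratedDerivWithin_polynomial R hs.2 j hsR hR,
      iteratedDerivWithin_of_subset (Icc_subset_Icc_right hs.2.le) (uniqueDiffOn_Icc hs.1) hIcc
        hsmooth hsL,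
      iteratedDerivWithin_of_subset (Icc_subset_Icc_left hs.1.le) (uniqueDiffOn_Icc hs.2) hIcc
        hsmooth hsR, sub_self]
  · rw [iterate_derivative_sub, eval_sub, ← iteratedDerivWithin_polynomial L hs.1 _ hsL hL,
      ← iteratedDerivWithin_polynomial R hs.2 _ hsR hR]
    exact hG.jump s hs

theorem IsGreenFunction.exists_isGreenPair {n : ℕ} (hn : 1 ≤ n) {G : ℝ → ℝ → ℝ}
    (hG : IsGreenFunction n G) {s : ℝ} (hs : s ∈ Ioo (-1 : ℝ) 1) :
    ∃ L R : ℝ[X], IsGreenPair n s L R ∧ (∀ t ∈ Icc (-1) s, G t s = L.eval t) ∧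
      ∀ t ∈ Icc s 1, G t s = R.eval t := by
  have hsign : ((-1 : ℝ) ^ n) ≠ 0 := by positivity
  obtain ⟨L, hLdeg, hL⟩ := exists_polynomial_of_iteratedDerivWithin_eq_zero (m := 2 * n) hs.1.le
    (contDiffOn_infty.1 (hG.contDiffOn_left s hs) _)
    fun t ht => (mul_eq_zero.1 (hG.eqn_left s hs t ht)).resolve_left hsign
  obtain ⟨R, hRdeg, hR⟩ := exists_polynomial_of_iteratedDerivWithin_eq_zero (m := 2 * n) hs.2.le
    (contDiffOn_infty.1 (hG.contDiffOn_right s hs) _)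
    fun t ht => (mul_eq_zero.1 (hG.eqn_right s hs t ht)).resolve_left hsign
  refine ⟨L, R, ⟨hLdeg, hRdeg, ?_, ?_, hG.sub_eq_of_eqOn hn hs hLdeg hRdeg hL hR⟩, hL, hR⟩
  · refine X_sub_C_pow_dvd_iff_iterate_derivative_eval_eq_zero.2 fun j hj => ?_
    rw [← iteratedDerivWithin_polynomial L hs.1 j (left_mem_Icc.2 hs.1.le) hL]
    exact hG.bdry_left s hs j hj
  · refine X_sub_C_pow_dvd_iff_iterate_derivative_eval_eq_zero.2 fun j hj => ?_
    rw [← iteratedDerivWithin_polynomial R hs.2 j (right_mem_Icc.2 hs.2.le) hR]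
    exact hG.bdry_right s hs j hj

end PiecewisePolynomials

section Boggio

open Polynomial

theorem sum_neg_one_pow_mul_choose_div {K : Type*} [Field K] [CharZero K] (m N : ℕ) :
    ∑ j ∈ Finset.range (m + 1), (m.choose j : K) * ((-1) ^ j / (N + 1 + j))
      = m ! * N ! / (N + m + 1)! := by
  induction m generalizing N with
  | zero =>
    have hN : (N ! : K) ≠ 0 := Nat.cast_ne_zero.2 N.factorial_ne_zero
    have hN1 : (N : K) + 1 ≠ 0 := Nat.cast_add_one_ne_zero N
    simp [Nat.factorial_succ, field]
  | succ m ih =>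
    have hshift : ∑ i ∈ Finset.range (m + 1),
        (m.choose i : K) * ((-1) ^ (i + 1) / (N + 1 + (i + 1 : ℕ)))
          = -(m ! * (N + 1)! / (N + 1 + m + 1)!) := by
      rw [← ih (N + 1), ← Finset.sum_neg_distrib]
      refine Finset.sum_congr rfl fun i _ => ?_
      push_cast
      rw [pow_succ, show (N : K) + 1 + (i + 1) = N + 1 + 1 + i by ring]
      ring
    refine (Finset.sum_choose_succ_mul (fun j _ => (-1) ^ j / ((N : K) + 1 + j)) m).trans ?_
    have hfac : ((N + m + 1)! : K) ≠ 0 := Nat.cast_ne_zero.2 (Nat.factorial_ne_zero _)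
    have hsucc : (N : K) + m + 1 + 1 ≠ 0 := by exact_mod_cast (N + m + 1).succ_ne_zero
    rw [ih N, hshift, show N + (m + 1) + 1 = (N + m + 1) + 1 by ring,
      show N + 1 + m + 1 = (N + m + 1) + 1 by ring, Nat.factorial_succ (N + m + 1),
      Nat.factorial_succ N, Nat.factorial_succ m]
    push_cast
    field_simp
    ring

/-- For real `a` and `d` this is `(2^{2n-1} (n-1)!²)⁻¹ ∫_0^a y^{n-1} (y + 2d)^{n-1} dy`, the
integral in Boggio's formula for the polyharmonic Green's function. It is written as a sum, with
arguments in any real algebra, so that the same expression also makes sense for polynomials. -/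
noncomputable def boggioPrimitive {A : Type*} [CommRing A] [Algebra ℝ A] (n : ℕ) (a d : A) : A :=
  (2 ^ (2 * n - 1) * ((n - 1)! : ℝ) ^ 2)⁻¹ • ∑ j ∈ Finset.range n,
    ((n - 1).choose j / (n + j) : ℝ) • (a ^ (n + j) * (2 * d) ^ (n - 1 - j))

theorem map_boggioPrimitive {A B : Type*} [CommRing A] [Algebra ℝ A] [CommRing B] [Algebra ℝ B]
    (f : A →ₐ[ℝ] B) (n : ℕ) (a d : A) :
    f (boggioPrimitive n a d) = boggioPrimitive n (f a) (f d) := by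
  simp [boggioPrimitive, map_ofNat f]

theorem pow_dvd_boggioPrimitive {A : Type*} [CommRing A] [Algebra ℝ A] (n : ℕ) {a b : A}
    (h : b ∣ a) (d : A) : b ^ n ∣ boggioPrimitive n a d := by
  refine dvd_smul_of_dvd _ (Finset.dvd_sum fun j _ => dvd_smul_of_dvd _ (Dvd.dvd.mul_right ?_ _))
  exact (pow_dvd_pow_of_dvd h n).trans (pow_dvd_pow _ (Nat.le_add_right n j))

theorem degree_boggioPrimitive_lt {n : ℕ} (hn : 1 ≤ n) {P Q : ℝ[X]} (hP : P.natDegree ≤ 1)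
    (hQ : Q.natDegree ≤ 1) : (boggioPrimitive n P Q).degree < (2 * n : ℕ) := by
  have hterm : ∀ j ∈ Finset.range n,
      (((n - 1).choose j / (n + j) : ℝ) • (P ^ (n + j) * (2 * Q) ^ (n - 1 - j))).natDegree
        ≤ 2 * n - 1 := by
    intro j hj
    have hj' := Finset.mem_range.1 hj
    have hPpow : (P ^ (n + j)).natDegree ≤ (n + j) * 1 := natDegree_pow_le_of_le _ hP
    have hQpow : ((2 * Q) ^ (n - 1 - j)).natDegree ≤ (n - 1 - j) * 1 :=
      natDegree_pow_le_of_le _ ((natDegree_C_mul_le 2 Q).trans hQ)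
    exact (natDegree_smul_le _ _).trans (natDegree_mul_le.trans (by omega))
  refine degree_le_natDegree.trans_lt (Nat.cast_lt.2 ?_)
  exact ((natDegree_smul_le _ _).trans (natDegree_sum_le_of_forall_le _ _ hterm)).trans_lt
    (by omega)

theorem eval_boggioPrimitive (n : ℕ) (P Q : ℝ[X]) (t : ℝ) :
    (boggioPrimitive n P Q).eval t = boggioPrimitive n (P.eval t) (Q.eval t) := by
  simpa only [coe_aeval_eq_eval] using map_boggioPrimitive (aeval t) n P Q

theorem hasDerivAt_boggioPrimitive {n : ℕ} (hn : 1 ≤ n) (a d : ℝ) :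
    HasDerivAt (fun x => boggioPrimitive n x d)
      ((2 ^ (2 * n - 1) * ((n - 1)! : ℝ) ^ 2)⁻¹ * (a * (a + 2 * d)) ^ (n - 1)) a := by
  obtain ⟨m, rfl⟩ := Nat.exists_eq_add_of_le' hn
  simp only [boggioPrimitive, add_tsub_cancel_right, smul_eq_mul]
  refine HasDerivAt.const_mul _ ?_
  have hexpand : (a * (a + 2 * d)) ^ m = ∑ j ∈ Finset.range (m + 1),
      (m.choose j / ((m + 1 : ℕ) + j) : ℝ) *
        (((m + 1 + j : ℕ) : ℝ) * a ^ (m + 1 + j - 1) * (2 * d) ^ (m - j)) := by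
    rw [mul_pow, add_pow, Finset.mul_sum]
    refine Finset.sum_congr rfl fun j _ => ?_
    have : ((m + 1 : ℕ) : ℝ) + j ≠ 0 := by positivity
    rw [show m + 1 + j - 1 = m + j by omega, pow_add]
    push_cast at this ⊢
    field_simp
  rw [hexpand]
  exact HasDerivAt.fun_sum fun j _ =>
    ((hasDerivAt_pow (m + 1 + j) a).mul_const _).const_mul _

theorem boggioPrimitive_zero {n : ℕ} (hn : 1 ≤ n) (d : ℝ) : boggioPrimitive n 0 d = 0 := by
  have hpow : ∀ j, (0 : ℝ) ^ (n + j) = 0 := fun j => zero_pow (by omega)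
  simp [boggioPrimitive, hpow]

theorem boggioPrimitive_two_mul_neg {n : ℕ} (hn : 1 ≤ n) (d : ℝ) :
    boggioPrimitive n (2 * d) (-d) = -((-1) ^ n / ((2 * n - 1)! : ℝ) * d ^ (2 * n - 1)) := by
  obtain ⟨m, rfl⟩ := Nat.exists_eq_add_of_le' hn
  have hsum : ∑ j ∈ Finset.range (m + 1),
      (m.choose j / ((m + 1 : ℕ) + j) : ℝ) * ((2 * d) ^ (m + 1 + j) * (2 * -d) ^ (m - j))
      = (-1) ^ m * (2 * d) ^ (2 * m + 1) * (m ! * m ! / ((m + m + 1)! : ℝ)) := by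
    rw [← sum_neg_one_pow_mul_choose_div, Finset.mul_sum]
    refine Finset.sum_congr rfl fun j hj => ?_
    obtain ⟨i, rfl⟩ := Nat.exists_eq_add_of_le (Finset.mem_range_succ_iff.1 hj)
    have hsign : ((-1 : ℝ) ^ j) ^ 2 = 1 := by rw [← pow_mul, mul_comm, pow_mul]; simp
    rw [Nat.add_sub_cancel_left, show 2 * -d = (-1) * (2 * d) by ring, mul_pow (-1 : ℝ),
      pow_add (-1 : ℝ) j i, show 2 * (j + i) + 1 = (j + i + 1 + j) + i by ring, pow_add _ _ i]
    push_cast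
    linear_combination -(((j + i).choose j : ℝ) / (j + i + 1 + j) * (2 * d) ^ (j + i + 1 + j)
      * ((-1) ^ i * (2 * d) ^ i)) * hsign
  have hm : (m ! : ℝ) ≠ 0 := by positivity
  have h2m : ((2 * m + 1)! : ℝ) ≠ 0 := by positivity
  simp only [boggioPrimitive, add_tsub_cancel_right, smul_eq_mul]
  rw [hsum, show 2 * (m + 1) - 1 = 2 * m + 1 by omega, show m + m + 1 = 2 * m + 1 by ring,
    mul_pow, pow_succ (-1 : ℝ) m]
  field_simp

theorem boggioPrimitive_sub_boggioPrimitive {n : ℕ} (hn : 1 ≤ n) (c d : ℝ) :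
    boggioPrimitive n (c - d) d - boggioPrimitive n (c + d) (-d)
      = (-1) ^ n / ((2 * n - 1)! : ℝ) * d ^ (2 * n - 1) := by
  -- The two terms have the same derivative in `c`, so it suffices to compare them at `c = d`.
  have hderiv : ∀ c : ℝ, HasDerivAt
      (fun c => boggioPrimitive n (c - d) d - boggioPrimitive n (c + d) (-d)) 0 c := by
    intro c
    refine (((hasDerivAt_boggioPrimitive hn (c - d) d).comp_sub_const c d).sub
      ((hasDerivAt_boggioPrimitive hn (c + d) (-d)).comp_add_const c d)).congr_deriv ?_
    rw [show (c - d) * (c - d + 2 * d) = (c + d) * (c + d + 2 * -d) by ring, sub_self]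
  rw [is_const_of_deriv_eq_zero (fun c => (hderiv c).differentiableAt)
    (fun c => (hderiv c).deriv) c d, sub_self, boggioPrimitive_zero hn, ← two_mul,
    boggioPrimitive_two_mul_neg hn, zero_sub, neg_neg]

theorem boggioPrimitive_nonneg (n : ℕ) {a d : ℝ} (ha : 0 ≤ a) (hd : 0 ≤ d) :
    0 ≤ boggioPrimitive n a d := by
  simp only [boggioPrimitive, smul_eq_mul]
  positivity

/-- Boggio's formula for the Green's function of `(-1)^n d^{2n}/dt^{2n}` on `(-1, 1)`. -/
noncomputable def boggioKernel (n : ℕ) (t s : ℝ) : ℝ :=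
  boggioPrimitive n ((1 - max t s) * (1 + min t s)) |t - s|

theorem boggioKernel_comm (n : ℕ) (t s : ℝ) : boggioKernel n t s = boggioKernel n s t := by
  rw [boggioKernel, boggioKernel, max_comm, min_comm, abs_sub_comm]

theorem boggioKernel_nonneg (n : ℕ) {t s : ℝ} (ht : t ∈ Icc (-1 : ℝ) 1) (hs : s ∈ Icc (-1 : ℝ) 1) :
    0 ≤ boggioKernel n t s := by
  refine boggioPrimitive_nonneg n (mul_nonneg ?_ ?_) (abs_nonneg _)
  · linarith [max_le ht.2 hs.2]
  · linarith [le_min ht.1 hs.1]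

theorem continuous_boggioKernel (n : ℕ) :
    Continuous (fun z : ℝ × ℝ => boggioKernel n z.1 z.2) := by
  simp only [boggioKernel, boggioPrimitive]
  fun_prop

/-- The polynomial in `t` that agrees with `boggioKernel n t s` for `t ≤ s`. -/
noncomputable def boggioLeft (n : ℕ) (s : ℝ) : ℝ[X] :=
  boggioPrimitive n ((X - C (-1)) * C (1 - s)) (C s - X)

/-- The polynomial in `t` that agrees with `boggioKernel n t s` for `s ≤ t`. -/
noncomputable def boggioRight (n : ℕ) (s : ℝ) : ℝ[X] :=
  boggioPrimitive n ((X - C 1) * C (-(1 + s))) (X - C s)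

theorem isGreenPair_boggio {n : ℕ} (hn : 1 ≤ n) (s : ℝ) :
    IsGreenPair n s (boggioLeft n s) (boggioRight n s) where
  degree_left := degree_boggioPrimitive_lt hn (by compute_degree) (by compute_degree)
  degree_right := degree_boggioPrimitive_lt hn (by compute_degree) (by compute_degree)
  dvd_left := pow_dvd_boggioPrimitive n (dvd_mul_right _ _) _
  dvd_right := pow_dvd_boggioPrimitive n (dvd_mul_right _ _) _
  jump := by
    refine Polynomial.funext fun t => ?_
    simp only [boggioLeft, boggioRight, eval_sub, eval_boggioPrimitive, eval_mul, eval_C, eval_X,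
      eval_pow]
    rw [← boggioPrimitive_sub_boggioPrimitive hn (1 - t * s) (t - s)]
    congr 2 <;> ring

theorem boggioKernel_eq_eval_boggioLeft (n : ℕ) {t s : ℝ} (h : t ≤ s) :
    boggioKernel n t s = (boggioLeft n s).eval t := by
  rw [boggioKernel, boggioLeft, eval_boggioPrimitive, max_eq_right h, min_eq_left h,
    abs_of_nonpos (sub_nonpos.2 h)]
  simp only [eval_mul, eval_sub, eval_X, eval_C]
  congr 1 <;> ring

theorem boggioKernel_eq_eval_boggioRight (n : ℕ) {t s : ℝ} (h : s ≤ t) :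
    boggioKernel n t s = (boggioRight n s).eval t := by
  rw [boggioKernel, boggioRight, eval_boggioPrimitive, max_eq_left h, min_eq_right h,
    abs_of_nonneg (sub_nonneg.2 h)]
  simp only [eval_mul, eval_sub, eval_X, eval_C]
  congr 1
  ring

theorem IsGreenFunction.eq_boggioKernel {n : ℕ} (hn : 1 ≤ n) {G : ℝ → ℝ → ℝ}
    (hG : IsGreenFunction n G) {t s : ℝ} (ht : t ∈ Icc (-1 : ℝ) 1) (hs : s ∈ Ioo (-1 : ℝ) 1) :
    G t s = boggioKernel n t s := by
  obtain ⟨L, R, hLR, hL, hR⟩ := hG.exists_isGreenPair hn hs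
  obtain ⟨rfl, rfl⟩ := hLR.unique (isGreenPair_boggio hn s)
  rcases le_total t s with h | h
  · rw [hL t ⟨ht.1, h⟩, boggioKernel_eq_eval_boggioLeft n h]
  · rw [hR t ⟨h, ht.2⟩, boggioKernel_eq_eval_boggioRight n h]

end Boggio

section GreenRepresentation

open Polynomial

variable {E : Type*} [NormedAddCommGroup E] [NormedSpace ℝ E]

/-- The boundary term at `x` produced by integrating `P • u^{(m)}` by parts `m` times. -/
noncomputable def bilinearConcomitant (m : ℕ) (P : ℝ[X]) (u : ℝ → E) (x : ℝ) : E :=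
  ∑ j ∈ Finset.range m, ((-1) ^ j * (derivative^[j] P).eval x) • iteratedDeriv (m - 1 - j) u x

theorem bilinearConcomitant_succ (m : ℕ) (P : ℝ[X]) (u : ℝ → E) (x : ℝ) :
    bilinearConcomitant (m + 1) P u x
      = P.eval x • iteratedDeriv m u x - bilinearConcomitant m (derivative P) u x := by
  rw [bilinearConcomitant, Finset.sum_range_succ', add_comm, bilinearConcomitant, sub_eq_add_neg,
    ← Finset.sum_neg_distrib]
  congr 1
  · simp
  · refine Finset.sum_congr rfl fun j _ => ?_
    rw [← neg_smul, Function.iterate_succ_apply, show m + 1 - 1 - (j + 1) = m - 1 - j by omega,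
      pow_succ, mul_neg_one, neg_mul]

theorem bilinearConcomitant_sub (m : ℕ) (P Q : ℝ[X]) (u : ℝ → E) (x : ℝ) :
    bilinearConcomitant m (P - Q) u x
      = bilinearConcomitant m P u x - bilinearConcomitant m Q u x := by
  simp only [bilinearConcomitant, iterate_derivative_sub, eval_sub, mul_sub, sub_smul,
    Finset.sum_sub_distrib]

theorem bilinearConcomitant_eq_zero {m k : ℕ} {P : ℝ[X]} {u : ℝ → E} {x : ℝ}
    (hP : (X - C x) ^ k ∣ P) (hu : ∀ j < m - k, iteratedDeriv j u x = 0) :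
    bilinearConcomitant m P u x = 0 := by
  refine Finset.sum_eq_zero fun j hj => ?_
  have hjm := Finset.mem_range.1 hj
  rcases lt_or_ge j k with hjk | hjk
  · rw [X_sub_C_pow_dvd_iff_iterate_derivative_eval_eq_zero.1 hP j hjk, mul_zero, zero_smul]
  · rw [hu _ (by omega), smul_zero]

theorem bilinearConcomitant_C_mul_X_sub_C_pow (m : ℕ) (c : ℝ) (u : ℝ → E) (x : ℝ) :
    bilinearConcomitant (m + 1) (C c * (X - C x) ^ m) u x = ((-1) ^ m * (c * m !)) • u x := by
  have hzero : ∀ j < m, (derivative^[j] (C c * (X - C x) ^ m)).eval x = 0 :=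
    X_sub_C_pow_dvd_iff_iterate_derivative_eval_eq_zero.1 (dvd_mul_left _ _)
  rw [bilinearConcomitant, Finset.sum_range_succ, Finset.sum_eq_zero fun j hj => by
    rw [hzero j (Finset.mem_range.1 hj), mul_zero, zero_smul]]
  simp [iterate_derivative_C_mul, iterate_derivative_X_sub_pow_self]

theorem integral_eval_smul_iteratedDeriv [CompleteSpace E] {m : ℕ} {u : ℝ → E}
    (hu : ContDiff ℝ m u) (a b : ℝ) (P : ℝ[X]) :
    ∫ s in a..b, P.eval s • iteratedDeriv m u s
      = bilinearConcomitant m P u b - bilinearConcomitant m P u a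
        + (-1 : ℝ) ^ m • ∫ s in a..b, (derivative^[m] P).eval s • u s := by
  induction m generalizing P with
  | zero => simp [bilinearConcomitant]
  | succ m ih =>
    have hderiv : ∀ x, HasDerivAt (iteratedDeriv m u) (iteratedDeriv (m + 1) u x) x := fun x => by
      rw [iteratedDeriv_succ]
      exact (hu.differentiable_iteratedDeriv m (by exact_mod_cast m.lt_succ_self) x).hasDerivAt
    rw [intervalIntegral.integral_smul_deriv_eq_deriv_smul (fun x _ => P.hasDerivAt x)
        (fun x _ => hderiv x) ((derivative P).continuous.intervalIntegrable _ _)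
        ((hu.continuous_iteratedDeriv (m + 1) le_rfl).intervalIntegrable _ _),
      ih (hu.of_le (by exact_mod_cast m.le_succ)) (derivative P), bilinearConcomitant_succ m P u b,
      bilinearConcomitant_succ m P u a, Function.iterate_succ_apply, pow_succ, mul_neg_one,
      neg_smul]
    abel

theorem IsGreenPair.integral_smul_iteratedDeriv [CompleteSpace E] {n : ℕ} (hn : 1 ≤ n) {t : ℝ}
    {L R : ℝ[X]} (h : IsGreenPair n t L R) {u : ℝ → E} (hu : ContDiff ℝ (2 * n : ℕ) u)
    (hleft : ∀ j < n, iteratedDeriv j u (-1) = 0) (hright : ∀ j < n, iteratedDeriv j u 1 = 0) :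
    (∫ s in (-1 : ℝ)..t, L.eval s • iteratedDeriv (2 * n) u s)
      + ∫ s in t..1, R.eval s • iteratedDeriv (2 * n) u s = (-1 : ℝ) ^ n • u t := by
  have hL : bilinearConcomitant (2 * n) L u (-1) = 0 :=
    bilinearConcomitant_eq_zero h.dvd_left fun j hj => hleft j (by omega)
  have hR : bilinearConcomitant (2 * n) R u 1 = 0 :=
    bilinearConcomitant_eq_zero h.dvd_right fun j hj => hright j (by omega)
  have hjump : bilinearConcomitant (2 * n) R u t - bilinearConcomitant (2 * n) L u t
      = -((-1 : ℝ) ^ n • u t) := by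
    have hodd : Odd (2 * n - 1) := ⟨n - 1, by omega⟩
    have hfac : ((2 * n - 1)! : ℝ) ≠ 0 := by positivity
    have hvalue := bilinearConcomitant_C_mul_X_sub_C_pow (2 * n - 1)
      ((-1) ^ n / ((2 * n - 1)! : ℝ)) u t
    rw [← bilinearConcomitant_sub, h.jump]
    rwa [Nat.sub_add_cancel (by omega), hodd.neg_one_pow, div_mul_cancel₀ _ hfac, neg_one_mul,
      neg_smul] at hvalue
  rw [integral_eval_smul_iteratedDeriv hu, integral_eval_smul_iteratedDeriv hu, hL, hR,
    iterate_derivative_eq_zero_of_degree_lt h.degree_left,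
    iterate_derivative_eq_zero_of_degree_lt h.degree_right, ← neg_eq_iff_eq_neg.2 hjump]
  simp [sub_eq_add_neg]

theorem integral_intervalMeasure (f : ℝ → E) :
    ∫ s, f s ∂intervalMeasure = ∫ s in (-1 : ℝ)..1, f s := by
  rw [intervalIntegral.integral_of_le (by norm_num), intervalMeasure, integral_Ioc_eq_integral_Ioo]

theorem integral_boggioKernel_smul_iteratedDeriv [CompleteSpace E] {n : ℕ} (hn : 1 ≤ n)
    {u : ℝ → E} (hu : ContDiff ℝ (2 * n : ℕ) u) (hleft : ∀ j < n, iteratedDeriv j u (-1) = 0)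
    (hright : ∀ j < n, iteratedDeriv j u 1 = 0) {t : ℝ} (ht : t ∈ Icc (-1 : ℝ) 1) :
    ∫ s, boggioKernel n t s • iteratedDeriv (2 * n) u s ∂intervalMeasure = (-1 : ℝ) ^ n • u t := by
  have hcont : Continuous fun s => boggioKernel n t s • iteratedDeriv (2 * n) u s :=
    ((continuous_boggioKernel n).comp (by fun_prop : Continuous fun s : ℝ => (t, s))).smul
      (hu.continuous_iteratedDeriv _ le_rfl)
  rw [integral_intervalMeasure, ← intervalIntegral.integral_add_adjacent_intervals (b := t)
      (hcont.intervalIntegrable _ _) (hcont.intervalIntegrable _ _),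
    ← (isGreenPair_boggio hn t).integral_smul_iteratedDeriv hn hu hleft hright]
  congr 1
  · refine intervalIntegral.integral_congr fun s hs => ?_
    rw [uIcc_of_le ht.1] at hs
    rw [boggioKernel_comm, boggioKernel_eq_eval_boggioLeft n hs.2]
  · refine intervalIntegral.integral_congr fun s hs => ?_
    rw [uIcc_of_le ht.2] at hs
    rw [boggioKernel_comm, boggioKernel_eq_eval_boggioRight n hs.1]

end GreenRepresentation

section RisingFactorial

/-- The rising factorial `(x)_k = x (x + 1) ⋯ (x + k - 1)`. -/
noncomputable abbrev risingFactorial {S : Type*} [Semiring S] (k : ℕ) (x : S) : S :=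
  (ascPochhammer S k).eval x

@[simp]
theorem risingFactorial_zero {S : Type*} [Semiring S] (x : S) : risingFactorial 0 x = 1 := by
  simp [risingFactorial]

theorem risingFactorial_succ {S : Type*} [Semiring S] (k : ℕ) (x : S) :
    risingFactorial (k + 1) x = risingFactorial k x * (x + k) :=
  ascPochhammer_succ_eval k x

theorem risingFactorial_add {S : Type*} [CommSemiring S] (k m : ℕ) (x : S) :
    risingFactorial (k + m) x = risingFactorial k x * risingFactorial m (x + k) := by
  simp [risingFactorial, ← ascPochhammer_mul]

theorem sum_choose_mul_risingFactorial {S : Type*} [CommSemiring S] (N : ℕ) (a b : S) :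
    ∑ i ∈ Finset.range (N + 1),
        (N.choose i : S) * (risingFactorial i a * risingFactorial (N - i) b)
      = risingFactorial N (a + b) := by
  induction N with
  | zero => simp
  | succ N ih =>
    rw [Finset.sum_choose_succ_mul fun i j => risingFactorial i a * risingFactorial j b,
      ← Finset.sum_add_distrib, risingFactorial_succ, ← ih, Finset.sum_mul]
    refine Finset.sum_congr rfl fun i hi => ?_
    obtain ⟨j, rfl⟩ := Nat.exists_eq_add_of_le (Finset.mem_range_succ_iff.1 hi)
    rw [show i + j + 1 - i = j + 1 by omega, Nat.add_sub_cancel_left, risingFactorial_succ,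
      risingFactorial_succ]
    push_cast
    ring

theorem risingFactorial_one {S : Type*} [Semiring S] (k : ℕ) :
    risingFactorial k (1 : S) = k ! :=
  ascPochhammer_eval_one S k

theorem factorial_two_mul_eq {K : Type*} [Field K] [CharZero K] (m : ℕ) :
    ((2 * m)! : K) = 4 ^ m * m ! * risingFactorial m (1 / 2 : K) := by
  induction m with
  | zero => simp
  | succ m ih =>
    rw [show 2 * (m + 1) = 2 * m + 1 + 1 by ring, Nat.factorial_succ, Nat.factorial_succ,
      Nat.factorial_succ, risingFactorial_succ]
    push_cast
    rw [ih]
    field_simp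
    ring

theorem two_mul_risingFactorial_self {K : Type*} [Field K] [CharZero K] {n : ℕ} (hn : 1 ≤ n) :
    2 * risingFactorial n (n : K) = 4 ^ n * risingFactorial n (1 / 2 : K) := by
  have hfac : (n ! : K) ≠ 0 := by exact_mod_cast n.factorial_ne_zero
  have hrising : (n ! : K) * risingFactorial n (n + 1 : K) = (2 * n)! := by
    rw [← risingFactorial_one n, ← risingFactorial_one (2 * n), two_mul, risingFactorial_add,
      add_comm (1 : K)]
  have hshift : (n : K) * risingFactorial n (n + 1 : K) = risingFactorial n (n : K) * (2 * n) := by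
    have hleft := risingFactorial_add 1 n (n : K)
    have hright := risingFactorial_succ n (n : K)
    rw [add_comm, hright] at hleft
    simpa [risingFactorial, two_mul] using hleft.symm
  have hn0 : (n : K) ≠ 0 := by exact_mod_cast (by omega : n ≠ 0)
  refine mul_left_cancel₀ hn0 (mul_left_cancel₀ hfac ?_)
  rw [factorial_two_mul_eq] at hrising
  linear_combination (n : K) * hrising - (n ! : K) * hshift

theorem Gamma_add_natCast {x : ℝ} (hx : 0 < x) (k : ℕ) :
    Real.Gamma (x + k) = risingFactorial k x * Real.Gamma x := by
  induction k with
  | zero => simp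
  | succ k ih =>
    rw [Nat.cast_succ, ← add_assoc, Real.Gamma_add_one (by positivity), ih, risingFactorial_succ]
    ring

theorem risingFactorial_pos {x : ℝ} (hx : 0 < x) (k : ℕ) : 0 < risingFactorial k x :=
  ascPochhammer_pos k x hx

end RisingFactorial

section HypergeometricSum

/-- The `k`-th term of the series defining `hypergeometricRatio`. -/
noncomputable def hypergeometricTerm (n k : ℕ) : ℝ :=
  risingFactorial k (1 / 2 : ℝ) * risingFactorial k 1 * risingFactorial k (-n : ℝ) /
    (risingFactorial k (1 - 2 * n : ℝ) * risingFactorial k (n + 1 : ℝ) * k !)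

theorem hypergeometricRatio_eq (n : ℕ) :
    hypergeometricRatio n = ∑ k ∈ Finset.range (n + 1), hypergeometricTerm n k := rfl

theorem hypergeometricTerm_zero (n : ℕ) : hypergeometricTerm n 0 = 1 := by
  simp [hypergeometricTerm]

theorem hypergeometricTerm_succ (n k : ℕ) :
    hypergeometricTerm n (k + 1) = hypergeometricTerm n k *
      ((1 / 2 + k) / (n + 1 + k) * ((n - k) / (2 * n - 1 - k))) := by
  have hsign : (n - k) / (2 * n - 1 - k) = (-n + k) / (1 - 2 * n + k : ℝ) := by
    rw [← neg_div_neg_eq]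
    ring_nf
  simp only [hypergeometricTerm, risingFactorial_one, risingFactorial_succ, Nat.factorial_succ]
  rw [hsign, Nat.cast_mul, Nat.cast_succ, add_comm (1 : ℝ)]
  field_simp

theorem hypergeometricTerm_eq {n k : ℕ} (hk : k ≤ n) :
    hypergeometricTerm n k =
      (n ! : ℝ) ^ 2 * risingFactorial k (1 / 2 : ℝ) * risingFactorial (n - k) (n : ℝ)
        / (risingFactorial n (n : ℝ) * (n + k)! * (n - k)!) := by
  induction k with
  | zero =>
    rcases n.eq_zero_or_pos with rfl | hn
    · simp [hypergeometricTerm_zero]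
    · have hrising := (risingFactorial_pos (Nat.cast_pos.2 hn : (0 : ℝ) < n) n).ne'
      rw [hypergeometricTerm_zero, eq_comm, div_eq_one_iff_eq (by positivity)]
      simp
      ring
  | succ k ih =>
    obtain ⟨l, rfl⟩ := Nat.exists_eq_add_of_le hk
    have hpos : (0 : ℝ) < k + 1 + l := by positivity
    rw [hypergeometricTerm_succ, ih (by omega), show k + 1 + l - k = l + 1 by omega,
      Nat.add_sub_cancel_left, risingFactorial_succ, risingFactorial_succ, ← add_assoc,
      Nat.factorial_succ, Nat.factorial_succ]
    push_cast
    have hne : (2 * (k + 1 + l) - 1 - k : ℝ) ≠ 0 := by linarith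
    have hrising := (risingFactorial_pos hpos (k + 1 + l)).ne'
    field_simp
    ring

theorem hypergeometricTerm_pos {n k : ℕ} (hk : k ≤ n) : 0 < hypergeometricTerm n k := by
  rcases n.eq_zero_or_pos with rfl | hn
  · simp [Nat.le_zero.1 hk, hypergeometricTerm_zero]
  · have hhalf := risingFactorial_pos (x := 1 / 2) (by norm_num) k
    have hrising := risingFactorial_pos (Nat.cast_pos.2 hn : (0 : ℝ) < n)
    rw [hypergeometricTerm_eq hk]
    have := hrising n
    have := hrising (n - k)
    positivity

theorem hypergeometricTerm_mul_choose {n j i : ℕ} (h : j + i ≤ n) :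
    hypergeometricTerm n (j + i) * (n + (j + i)).choose (n + j) =
      (n ! : ℝ) ^ 2 * risingFactorial j (1 / 2 : ℝ)
        / (risingFactorial n (n : ℝ) * (n + j)! * (n - j)!)
        * ((n - j).choose i
          * (risingFactorial i (1 / 2 + j : ℝ) * risingFactorial (n - j - i) (n : ℝ))) := by
  have hchoose : ((n + (j + i)).choose (n + j) : ℝ) = (n + (j + i))! / ((n + j)! * i !) := by
    rw [Nat.cast_choose ℝ (by omega), show n + (j + i) - (n + j) = i by omega]
  rw [hypergeometricTerm_eq h, risingFactorial_add, hchoose, Nat.cast_choose ℝ (by omega),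
    Nat.sub_sub]
  field_simp

theorem sum_hypergeometricTerm_mul_choose {n j : ℕ} (hj : j ≤ n) :
    ∑ k ∈ Finset.range (n + 1), hypergeometricTerm n k * (n + k).choose (n + j) =
      (n ! : ℝ) ^ 2 * risingFactorial j (1 / 2 : ℝ)
        / (risingFactorial n (n : ℝ) * (n + j)! * (n - j)!)
        * risingFactorial (n - j) (1 / 2 + j + n : ℝ) := by
  have hvanish : ∀ k ∈ Finset.range j,
      hypergeometricTerm n k * ((n + k).choose (n + j) : ℝ) = 0 := fun k hk => by
    rw [Nat.choose_eq_zero_of_lt (Nat.add_lt_add_left (Finset.mem_range.1 hk) n), Nat.cast_zero,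
      mul_zero]
  rw [show n + 1 = j + (n - j + 1) by omega, Finset.sum_range_add, Finset.sum_eq_zero hvanish,
    zero_add, ← sum_choose_mul_risingFactorial, Finset.mul_sum]
  refine Finset.sum_congr rfl fun i hi => ?_
  have := Finset.mem_range.1 hi
  exact hypergeometricTerm_mul_choose (by omega)

/-- The constant `α_n` in `lowerFactor n = √2 (2n)! α_n`, for which `α_n w ≤ T_n w` when
`w t = (1 - t²)ⁿ`. -/
noncomputable def greenConstant (n : ℕ) : ℝ :=
  Real.Gamma (n + 1 / 2) / (2 * Real.Gamma (n + 1) * Real.Gamma (2 * n + 1 / 2))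

theorem lowerFactor_eq (n : ℕ) : lowerFactor n = √2 * (2 * n)! * greenConstant n := rfl

theorem greenConstant_eq (n : ℕ) :
    greenConstant n = 1 / (2 * n ! * risingFactorial n (n + 1 / 2 : ℝ)) := by
  have hGamma : Real.Gamma (2 * n + 1 / 2)
      = risingFactorial n (n + 1 / 2 : ℝ) * Real.Gamma (n + 1 / 2) := by
    rw [← Gamma_add_natCast (by positivity)]
    ring_nf
  have : Real.Gamma (n + 1 / 2 : ℝ) ≠ 0 := (Real.Gamma_pos_of_pos (by positivity)).ne'
  rw [greenConstant, hGamma, Real.Gamma_nat_eq_factorial]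
  field_simp

theorem greenConstant_pos (n : ℕ) : 0 < greenConstant n := by
  have := risingFactorial_pos (x := n + 1 / 2) (by positivity) n
  rw [greenConstant_eq]
  positivity

theorem greenConstant_mul_sum_hypergeometricTerm_mul_choose {n : ℕ} (hn : 1 ≤ n) (j : ℕ) :
    greenConstant n * ((2 * (n + j))! / (2 * j)!)
      * ∑ k ∈ Finset.range (n + 1), hypergeometricTerm n k * (n + k).choose (n + j)
        = n.choose j := by
  rcases lt_or_ge n j with hj | hj
  · rw [Nat.choose_eq_zero_of_lt hj, Finset.sum_eq_zero, mul_zero, Nat.cast_zero]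
    intro k hk
    rw [Nat.choose_eq_zero_of_lt (by have := Finset.mem_range.1 hk; omega), Nat.cast_zero, mul_zero]
  have hregroup : risingFactorial (n + j) (1 / 2 : ℝ) * risingFactorial (n - j) (1 / 2 + j + n : ℝ)
      = risingFactorial n (1 / 2 : ℝ) * risingFactorial n (n + 1 / 2 : ℝ) := by
    have hadd := risingFactorial_add (n + j) (n - j) (1 / 2 : ℝ)
    rw [show n + j + (n - j) = n + n by omega, risingFactorial_add n n, Nat.cast_add] at hadd
    rw [add_comm (n : ℝ), hadd, add_right_comm, add_assoc]
  have hself := two_mul_risingFactorial_self (K := ℝ) hn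
  have hn_pos := (risingFactorial_pos (Nat.cast_pos.2 hn : (0 : ℝ) < n) n).ne'
  have hhalf := (risingFactorial_pos (x := 1 / 2) (by norm_num) j).ne'
  have hhalf_add := (risingFactorial_pos (x := n + 1 / 2) (by positivity) n).ne'
  rw [sum_hypergeometricTerm_mul_choose hj, greenConstant_eq, factorial_two_mul_eq,
    factorial_two_mul_eq, Nat.cast_choose ℝ hj, pow_add]
  generalize risingFactorial n (n : ℝ) = Q at *
  generalize risingFactorial (n + j) (1 / 2 : ℝ) = E at *
  generalize risingFactorial (n - j) (1 / 2 + j + n : ℝ) = F at *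
  generalize risingFactorial n (n + 1 / 2 : ℝ) = D at *
  field_simp
  linear_combination (4 : ℝ) ^ n * hregroup - D * hself

end HypergeometricSum

section WeightIntegrals

open Polynomial

theorem coeff_one_sub_X_pow {R : Type*} [CommRing R] (m i : ℕ) :
    ((1 - X : R[X]) ^ m).coeff i = (-1) ^ i * m.choose i := by
  have hcomp : (1 - X : R[X]) ^ m = ((1 + X) ^ m).comp (C (-1) * X) := by simp [sub_eq_add_neg]
  rw [hcomp, comp_C_mul_X_coeff, coeff_one_add_X_pow, mul_comm]

theorem expand_two_one_sub_X_pow {R : Type*} [CommRing R] (m : ℕ) :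
    expand R 2 ((1 - X) ^ m) = (1 - X ^ 2) ^ m := by
  simp

theorem iterate_derivative_expand_two {R : Type*} [CommSemiring R] {P Q : R[X]} {m : ℕ}
    (h : ∀ j, (2 * (m + j)).descFactorial (2 * m) • P.coeff (m + j) = Q.coeff j) :
    derivative^[2 * m] (expand R 2 P) = expand R 2 Q := by
  ext e
  rw [coeff_iterate_derivative]
  by_cases he : 2 ∣ e
  · obtain ⟨j, rfl⟩ := he
    rw [show 2 * j + 2 * m = 2 * (m + j) by ring, coeff_expand_mul' two_pos,
      coeff_expand_mul' two_pos, h]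
  · have he' : ¬2 ∣ e + 2 * m := by omega
    rw [coeff_expand two_pos, if_neg he', coeff_expand two_pos, if_neg he, smul_zero]

theorem iterate_derivative_one_sub_X_sq_pow {R : Type*} [CommRing R] (n : ℕ) :
    derivative^[2 * n] ((1 - X ^ 2 : R[X]) ^ n) = C ((-1) ^ n * (2 * n)! : R) := by
  rw [← expand_two_one_sub_X_pow, ← expand_C 2 ((-1) ^ n * (2 * n)! : R)]
  refine iterate_derivative_expand_two fun j => ?_
  rw [coeff_one_sub_X_pow, coeff_C]
  rcases j.eq_zero_or_pos with rfl | hj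
  · simp [Nat.descFactorial_self, mul_comm]
  · rw [Nat.choose_eq_zero_of_lt (by omega), if_neg hj.ne', Nat.cast_zero, mul_zero, smul_zero]

theorem iterate_derivative_sum_one_sub_X_sq_pow {n : ℕ} (hn : 1 ≤ n) :
    derivative^[2 * n] (C (greenConstant n) * ∑ k ∈ Finset.range (n + 1),
      C (hypergeometricTerm n k) * (1 - X ^ 2) ^ (n + k)) = C ((-1) ^ n) * (1 - X ^ 2) ^ n := by
  have hexpand : C (greenConstant n) * ∑ k ∈ Finset.range (n + 1),
      C (hypergeometricTerm n k) * (1 - X ^ 2) ^ (n + k) = expand ℝ 2 (C (greenConstant n)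
        * ∑ k ∈ Finset.range (n + 1), C (hypergeometricTerm n k) * (1 - X) ^ (n + k)) := by
    simp only [map_mul, map_sum, expand_C, expand_two_one_sub_X_pow]
  rw [hexpand, ← expand_two_one_sub_X_pow, ← expand_C 2 ((-1 : ℝ) ^ n), ← map_mul]
  refine iterate_derivative_expand_two fun j => ?_
  have hdesc : ((2 * (n + j)).descFactorial (2 * n) : ℝ) = (2 * (n + j))! / (2 * j)! := by
    rw [Nat.descFactorial_eq_div (by omega), Nat.cast_div (Nat.factorial_dvd_factorial (by omega))
      (by positivity), show 2 * (n + j) - 2 * n = 2 * j by omega]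
  simp only [coeff_C_mul, finsetSum_coeff, coeff_one_sub_X_pow, nsmul_eq_mul, hdesc,
    mul_left_comm (hypergeometricTerm n _), ← Finset.mul_sum]
  rw [← greenConstant_mul_sum_hypergeometricTerm_mul_choose hn j, pow_add]
  ring

theorem iteratedDeriv_eval (P : ℝ[X]) (j : ℕ) :
    iteratedDeriv j (fun x => P.eval x) = fun x => (derivative^[j] P).eval x := by
  induction j with
  | zero => simp
  | succ j ih =>
    funext x
    rw [iteratedDeriv_succ, ih, Polynomial.deriv, Function.iterate_succ_apply']

theorem integral_boggioKernel_mul_eval {n : ℕ} (hn : 1 ≤ n) {U V : ℝ[X]}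
    (hU : (1 - X ^ 2) ^ n ∣ U) (hV : derivative^[2 * n] U = C ((-1) ^ n) * V) {t : ℝ}
    (ht : t ∈ Icc (-1 : ℝ) 1) :
    ∫ s, boggioKernel n t s * V.eval s ∂intervalMeasure = U.eval t := by
  have hfactor : (1 - X ^ 2 : ℝ[X]) = (X - C 1) * (-(X - C (-1))) := by
    simp only [map_neg, map_one]
    ring
  have hvanish : ∀ x : ℝ, X - C x ∣ 1 - X ^ 2 →
      ∀ j < n, iteratedDeriv j (fun s => U.eval s) x = 0 := fun x hx j hj => by
    rw [iteratedDeriv_eval]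
    exact X_sub_C_pow_dvd_iff_iterate_derivative_eval_eq_zero.1
      ((pow_dvd_pow_of_dvd hx n).trans hU) j hj
  have hgreen := integral_boggioKernel_smul_iteratedDeriv hn (contDiff_polynomial_eval U)
    (hvanish _ (hfactor ▸ (dvd_neg.2 dvd_rfl).mul_left _))
    (hvanish _ (hfactor ▸ dvd_mul_right _ _)) ht
  simp only [iteratedDeriv_eval, hV, eval_mul, eval_C, smul_eq_mul,
    mul_left_comm (boggioKernel n t _)] at hgreen
  rw [integral_const_mul] at hgreen
  exact mul_left_cancel₀ (by positivity) hgreen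

theorem integral_boggioKernel {n : ℕ} (hn : 1 ≤ n) {t : ℝ} (ht : t ∈ Icc (-1 : ℝ) 1) :
    ∫ s, boggioKernel n t s ∂intervalMeasure = (1 - t ^ 2) ^ n / (2 * n)! := by
  have h := integral_boggioKernel_mul_eval hn dvd_rfl
    ((iterate_derivative_one_sub_X_sq_pow n).trans (map_mul _ _ _)) ht
  simp only [eval_C, integral_mul_const] at h
  rw [eq_div_iff (by positivity), h]
  simp

theorem integral_boggioKernel_mul_one_sub_sq_pow {n : ℕ} (hn : 1 ≤ n) {t : ℝ}
    (ht : t ∈ Icc (-1 : ℝ) 1) :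
    ∫ s, boggioKernel n t s * (1 - s ^ 2) ^ n ∂intervalMeasure
      = greenConstant n * ∑ k ∈ Finset.range (n + 1),
        hypergeometricTerm n k * (1 - t ^ 2) ^ (n + k) := by
  have hdvd : (1 - X ^ 2 : ℝ[X]) ^ n ∣ C (greenConstant n) * ∑ k ∈ Finset.range (n + 1),
      C (hypergeometricTerm n k) * (1 - X ^ 2) ^ (n + k) :=
    (Finset.dvd_sum fun k _ => (pow_dvd_pow _ (by omega)).mul_left _).mul_left _
  simpa [eval_finsetSum] using
    integral_boggioKernel_mul_eval hn hdvd (iterate_derivative_sum_one_sub_X_sq_pow hn) ht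

theorem one_sub_sq_nonneg {t : ℝ} (ht : t ∈ Icc (-1 : ℝ) 1) : 0 ≤ 1 - t ^ 2 := by
  nlinarith [ht.1, ht.2]

theorem integral_boggioKernel_mul_one_sub_sq_pow_le {n : ℕ} (hn : 1 ≤ n) {t : ℝ}
    (ht : t ∈ Icc (-1 : ℝ) 1) :
    ∫ s, boggioKernel n t s * (1 - s ^ 2) ^ n ∂intervalMeasure
      ≤ hypergeometricRatio n * greenConstant n * (1 - t ^ 2) ^ n := by
  rw [integral_boggioKernel_mul_one_sub_sq_pow hn ht, mul_comm (hypergeometricRatio n), mul_assoc,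
    hypergeometricRatio_eq, Finset.sum_mul]
  refine mul_le_mul_of_nonneg_left (Finset.sum_le_sum fun k hk => ?_) (greenConstant_pos n).le
  refine mul_le_mul_of_nonneg_left ?_ (hypergeometricTerm_pos (Finset.mem_range_succ_iff.1 hk)).le
  exact pow_le_pow_of_le_one (one_sub_sq_nonneg ht) (sub_le_self _ (sq_nonneg t)) (by omega)

theorem le_integral_boggioKernel_mul_one_sub_sq_pow {n : ℕ} (hn : 1 ≤ n) {t : ℝ}
    (ht : t ∈ Icc (-1 : ℝ) 1) :
    greenConstant n * (1 - t ^ 2) ^ n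
      ≤ ∫ s, boggioKernel n t s * (1 - s ^ 2) ^ n ∂intervalMeasure := by
  rw [integral_boggioKernel_mul_one_sub_sq_pow hn ht]
  refine mul_le_mul_of_nonneg_left ?_ (greenConstant_pos n).le
  have h := Finset.single_le_sum
    (f := fun k => hypergeometricTerm n k * (1 - t ^ 2) ^ (n + k)) (s := Finset.range (n + 1))
    (fun k hk => mul_nonneg (hypergeometricTerm_pos (Finset.mem_range_succ_iff.1 hk)).le
      (pow_nonneg (one_sub_sq_nonneg ht) _)) (Finset.mem_range.2 n.succ_pos)
  simpa [hypergeometricTerm_zero] using h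

end WeightIntegrals

section Asymptotics

open Filter Topology

theorem one_le_hypergeometricRatio (n : ℕ) : 1 ≤ hypergeometricRatio n := by
  rw [hypergeometricRatio_eq, ← hypergeometricTerm_zero n]
  exact Finset.single_le_sum (f := hypergeometricTerm n)
    (fun k hk => (hypergeometricTerm_pos (Finset.mem_range_succ_iff.1 hk)).le)
    (Finset.mem_range.2 n.succ_pos)

theorem hypergeometricTerm_succ_le {n k : ℕ} (hk : k + 1 ≤ n) :
    hypergeometricTerm n (k + 1) ≤ 1 / (n + 1) * (2 / 3) ^ k := by
  induction k with
  | zero =>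
    have hn : (1 : ℝ) ≤ n := by exact_mod_cast hk
    rw [hypergeometricTerm_succ, hypergeometricTerm_zero, one_mul, pow_zero, Nat.cast_zero,
      add_zero, add_zero, sub_zero, sub_zero]
    have hden : (0 : ℝ) < 2 * n - 1 := by linarith
    have hratio : (n : ℝ) / (2 * n - 1) ≤ 1 := by
      rw [div_le_one hden]
      linarith
    refine mul_le_mul ?_ hratio (by positivity) (by positivity)
    gcongr
    norm_num
  | succ k ih =>
    have hkn : (k : ℝ) + 1 + 1 ≤ n := by exact_mod_cast hk
    have : (0 : ℝ) ≤ k := k.cast_nonneg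
    have hfirst : (1 / 2 + ((k : ℝ) + 1)) / (n + 1 + (k + 1)) ≤ 1 := by
      rw [div_le_one (by positivity)]
      linarith
    have hsecond : ((n : ℝ) - (k + 1)) / (2 * n - 1 - (k + 1)) ≤ 2 / 3 := by
      rw [div_le_div_iff₀ (by linarith) (by norm_num)]
      linarith
    have hsecond_nonneg : 0 ≤ ((n : ℝ) - (k + 1)) / (2 * n - 1 - (k + 1)) :=
      div_nonneg (by linarith) (by linarith)
    rw [hypergeometricTerm_succ, pow_succ, ← mul_assoc (1 / _), Nat.cast_succ]
    refine mul_le_mul (ih (by omega)) ?_ (by positivity) (by positivity)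
    simpa only [one_mul] using mul_le_mul hfirst hsecond hsecond_nonneg zero_le_one

theorem hypergeometricRatio_le (n : ℕ) : hypergeometricRatio n ≤ 1 + 3 / (n + 1) := by
  rw [hypergeometricRatio_eq, Finset.sum_range_succ', hypergeometricTerm_zero, add_comm]
  gcongr
  calc ∑ k ∈ Finset.range n, hypergeometricTerm n (k + 1)
      ≤ ∑ k ∈ Finset.range n, 1 / ((n : ℝ) + 1) * (2 / 3) ^ k :=
        Finset.sum_le_sum fun k hk => hypergeometricTerm_succ_le (Finset.mem_range.1 hk)
    _ = 1 / ((n : ℝ) + 1) * ∑ k ∈ Finset.range n, (2 / 3 : ℝ) ^ k := by rw [Finset.mul_sum]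
    _ ≤ 1 / ((n : ℝ) + 1) * (1 - 2 / 3)⁻¹ := by
        gcongr
        rw [← tsum_geometric_of_lt_one (by norm_num) (by norm_num)]
        exact (summable_geometric_of_lt_one (by norm_num) (by norm_num)).sum_le_tsum _
          fun _ _ => by positivity
    _ = 3 / (n + 1) := by
        rw [div_mul_eq_mul_div]
        norm_num

theorem tendsto_hypergeometricRatio : Tendsto hypergeometricRatio atTop (𝓝 1) := by
  have hlim : Tendsto (fun n : ℕ => 1 + 3 / ((n : ℝ) + 1)) atTop (𝓝 1) := by
    simpa [div_eq_mul_inv] using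
      ((tendsto_one_div_add_atTop_nhds_zero_nat (𝕜 := ℝ)).const_mul 3).const_add 1
  exact tendsto_of_tendsto_of_tendsto_of_le_of_le tendsto_const_nhds hlim
    one_le_hypergeometricRatio hypergeometricRatio_le

theorem Gamma_add_half_sq_le {x : ℝ} (hx : 0 < x) :
    Real.Gamma (x + 1 / 2) ^ 2 ≤ Real.Gamma x * Real.Gamma (x + 1) := by
  have hconvex := Real.Gamma_mul_add_mul_le_rpow_Gamma_mul_rpow_Gamma (s := x) (t := x + 1)
    (a := 1 / 2) (b := 1 / 2) hx (by positivity) (by norm_num) (by norm_num) (by norm_num)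
  rw [show 1 / 2 * x + 1 / 2 * (x + 1) = x + 1 / 2 by ring, ← Real.sqrt_eq_rpow,
    ← Real.sqrt_eq_rpow, ← Real.sqrt_mul (Real.Gamma_pos_of_pos hx).le] at hconvex
  exact (Real.le_sqrt' (Real.Gamma_pos_of_pos (by positivity))).1 hconvex

/-- The Wallis ratio `Γ(x + 1/2) / Γ(x + 1)`. -/
noncomputable def wallisRatio (x : ℝ) : ℝ := Real.Gamma (x + 1 / 2) / Real.Gamma (x + 1)

theorem wallisRatio_sq_le {x : ℝ} (hx : 0 < x) : wallisRatio x ^ 2 ≤ 1 / x := by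
  have := Real.Gamma_pos_of_pos hx
  have hlogConvex := Gamma_add_half_sq_le hx
  rw [Real.Gamma_add_one hx.ne'] at hlogConvex
  rw [wallisRatio, Real.Gamma_add_one hx.ne', div_pow, div_le_div_iff₀ (by positivity) hx]
  nlinarith

theorem le_wallisRatio_sq {x : ℝ} (hx : 0 ≤ x) : 1 / (x + 1 / 2) ≤ wallisRatio x ^ 2 := by
  have : 0 < Real.Gamma (x + 1) := Real.Gamma_pos_of_pos (by positivity)
  have hlogConvex := Gamma_add_half_sq_le (x := x + 1 / 2) (by positivity)
  rw [Real.Gamma_add_one (s := x + 1 / 2) (by positivity), show x + 1 / 2 + 1 / 2 = x + 1 by ring]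
    at hlogConvex
  rw [wallisRatio, div_pow, div_le_div_iff₀ (by positivity) (by positivity)]
  linarith

theorem lowerFactor_sq (n : ℕ) :
    lowerFactor n ^ 2 = wallisRatio n ^ 2 / (2 * wallisRatio (2 * n) ^ 2) := by
  have hfactorial : Real.Gamma (2 * n + 1 : ℝ) = (2 * n)! := by
    exact_mod_cast Real.Gamma_nat_eq_factorial (2 * n)
  have hGamma : ∀ x : ℝ, 0 < x → Real.Gamma x ≠ 0 := fun x hx => (Real.Gamma_pos_of_pos hx).ne'
  have := hGamma (2 * n + 1 / 2) (by positivity)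
  have := hGamma (n + 1) (by positivity)
  rw [lowerFactor, wallisRatio, wallisRatio, hfactorial, mul_pow, mul_pow,
    Real.sq_sqrt zero_le_two]
  field_simp

theorem lowerFactor_pos (n : ℕ) : 0 < lowerFactor n := by
  rw [lowerFactor_eq]
  have := greenConstant_pos n
  positivity

theorem le_lowerFactor_sq (n : ℕ) : (n : ℝ) / (n + 1 / 2) ≤ lowerFactor n ^ 2 := by
  rcases n.eq_zero_or_pos with rfl | hn
  · simp [sq_nonneg]
  have hn' : (0 : ℝ) < n := Nat.cast_pos.2 hn
  have hpos := (le_wallisRatio_sq (by positivity : (0 : ℝ) ≤ 2 * n)).trans_lt' (by positivity)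
  rw [lowerFactor_sq]
  calc (n : ℝ) / (n + 1 / 2) = 1 / (n + 1 / 2) / (2 * (1 / (2 * n))) := by field_simp
    _ ≤ wallisRatio n ^ 2 / (2 * wallisRatio (2 * n) ^ 2) := by
      gcongr
      · exact le_wallisRatio_sq hn'.le
      · exact wallisRatio_sq_le (by positivity)

theorem lowerFactor_sq_le {n : ℕ} (hn : 1 ≤ n) : lowerFactor n ^ 2 ≤ 1 + 1 / (4 * n) := by
  have hn' : (0 : ℝ) < n := Nat.cast_pos.2 hn
  rw [lowerFactor_sq]
  calc wallisRatio n ^ 2 / (2 * wallisRatio (2 * n) ^ 2)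
      ≤ 1 / (n : ℝ) / (2 * (1 / (2 * n + 1 / 2))) := by
        gcongr
        · exact wallisRatio_sq_le hn'
        · exact le_wallisRatio_sq (by positivity)
    _ = 1 + 1 / (4 * n) := by
        field_simp
        ring

theorem tendsto_lowerFactor : Tendsto lowerFactor atTop (𝓝 1) := by
  have hlower : Tendsto (fun n : ℕ => (n : ℝ) / (n + 1 / 2)) atTop (𝓝 1) :=
    tendsto_natCast_div_add_atTop (1 / 2 : ℝ)
  have hupper : Tendsto (fun n : ℕ => 1 + 1 / (4 * n : ℝ)) atTop (𝓝 1) := by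
    simpa [mul_comm] using
      ((tendsto_one_div_atTop_nhds_zero_nat (𝕜 := ℝ)).const_mul 4⁻¹).const_add 1
  have hsq : Tendsto (fun n => lowerFactor n ^ 2) atTop (𝓝 1) :=
    tendsto_of_tendsto_of_tendsto_of_le_of_le' hlower hupper
      (Eventually.of_forall le_lowerFactor_sq)
      ((eventually_ge_atTop 1).mono fun _ => lowerFactor_sq_le)
  simpa [Real.sqrt_sq (lowerFactor_pos _).le] using hsq.sqrt

theorem tendsto_upperFactor : Tendsto upperFactor atTop (𝓝 1) :=
  one_mul (1 : ℝ) ▸ tendsto_hypergeometricRatio.mul tendsto_lowerFactor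

end Asymptotics

section SchurTest

variable {α β E E' : Type*} [MeasurableSpace α] [MeasurableSpace β] {μ : Measure α} {ν : Measure β}
  [ENorm E] [TopologicalSpace E'] [ContinuousENorm E'] {F : α → E} {f : β → E'}

theorem rpow_lintegral_le_lintegral_rpow_mul_inv {p q : ℝ} (hpq : p.HolderConjugate q)
    {f h : β → ℝ≥0∞} (hf : AEMeasurable f ν) (hh : AEMeasurable h ν) (h_zero : ∀ᵐ s ∂ν, h s ≠ 0)
    (h_top : ∀ᵐ s ∂ν, h s ≠ ∞) :
    (∫⁻ s, f s ∂ν) ^ p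
      ≤ (∫⁻ s, (f s * (h s)⁻¹) ^ p ∂ν) * (∫⁻ s, h s ^ q ∂ν) ^ (p / q) := by
  have hp := hpq.pos
  have hsplit : ∫⁻ s, f s ∂ν = ∫⁻ s, ((fun s => f s * (h s)⁻¹) * h) s ∂ν := by
    refine lintegral_congr_ae ?_
    filter_upwards [h_zero, h_top] with s hs_zero hs_top
    rw [Pi.mul_apply, mul_assoc, ENNReal.inv_mul_cancel hs_zero hs_top, mul_one]
  calc (∫⁻ s, f s ∂ν) ^ p
      ≤ ((∫⁻ s, (f s * (h s)⁻¹) ^ p ∂ν) ^ (1 / p) * (∫⁻ s, h s ^ q ∂ν) ^ (1 / q)) ^ p := by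
        rw [hsplit]
        exact ENNReal.rpow_le_rpow
          (ENNReal.lintegral_mul_le_Lp_mul_Lq ν hpq (hf.mul hh.inv) hh) hp.le
    _ = (∫⁻ s, (f s * (h s)⁻¹) ^ p ∂ν) * (∫⁻ s, h s ^ q ∂ν) ^ (p / q) := by
        rw [ENNReal.mul_rpow_of_nonneg _ _ hp.le, ← ENNReal.rpow_mul, ← ENNReal.rpow_mul,
          one_div_mul_cancel hp.ne', ENNReal.rpow_one, one_div_mul_eq_div]

theorem rpow_lintegral_mul_le {p q : ℝ} (hpq : p.HolderConjugate q) {k f h : β → ℝ≥0∞}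
    (hk : AEMeasurable k ν) (hf : AEMeasurable f ν) (hh : AEMeasurable h ν)
    (h_zero : ∀ᵐ s ∂ν, h s ≠ 0) (h_top : ∀ᵐ s ∂ν, h s ≠ ∞) :
    (∫⁻ s, k s * f s ∂ν) ^ p
      ≤ (∫⁻ s, k s * (f s * (h s)⁻¹) ^ p ∂ν) * (∫⁻ s, k s * h s ^ q ∂ν) ^ (p / q) := by
  have hac := withDensity_absolutelyContinuous ν k
  have hweight : ∀ g : β → ℝ≥0∞, AEMeasurable g ν →
      ∫⁻ s, g s ∂ν.withDensity k = ∫⁻ s, k s * g s ∂ν := fun g hg => by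
    simp only [lintegral_withDensity_eq_lintegral_mul₀ hk hg, Pi.mul_apply]
  have h_withDensity := rpow_lintegral_le_lintegral_rpow_mul_inv hpq (hf.mono_ac hac)
    (hh.mono_ac hac) (hac.ae_le h_zero) (hac.ae_le h_top)
  rwa [hweight f hf, hweight (fun s => (f s * (h s)⁻¹) ^ p) ((hf.mul hh.inv).pow_const p),
    hweight (fun s => h s ^ q) (hh.pow_const q)] at h_withDensity

theorem rpow_lintegral_mul_le_of_le {p q : ℝ} (hpq : p.HolderConjugate q) {k f h : β → ℝ≥0∞}
    (hk : AEMeasurable k ν) (hf : AEMeasurable f ν) (hh : AEMeasurable h ν)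
    (h_zero : ∀ᵐ s ∂ν, h s ≠ 0) (h_top : ∀ᵐ s ∂ν, h s ≠ ∞) {A c : ℝ≥0∞}
    (hA : ∫⁻ s, k s * h s ^ q ∂ν ≤ A * c ^ q) :
    (∫⁻ s, k s * f s ∂ν) ^ p ≤ A ^ (p / q) * ∫⁻ s, c ^ p * (k s * (f s * (h s)⁻¹) ^ p) ∂ν := by
  have hp := hpq.pos
  have hq := hpq.symm.pos
  calc (∫⁻ s, k s * f s ∂ν) ^ p
      ≤ (∫⁻ s, k s * (f s * (h s)⁻¹) ^ p ∂ν) * (A * c ^ q) ^ (p / q) := by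
        grw [rpow_lintegral_mul_le hpq hk hf hh h_zero h_top, hA]
    _ = A ^ (p / q) * (c ^ p * ∫⁻ s, k s * (f s * (h s)⁻¹) ^ p ∂ν) := by
        rw [ENNReal.mul_rpow_of_nonneg _ _ (by positivity), ← ENNReal.rpow_mul,
          mul_div_cancel₀ _ hq.ne']
        ring
    _ = A ^ (p / q) * ∫⁻ s, c ^ p * (k s * (f s * (h s)⁻¹) ^ p) ∂ν := by
        congr 1
        exact (lintegral_const_mul'' _ (hk.mul ((hf.mul hh.inv).pow_const p))).symm

theorem lintegral_rpow_lintegral_mul_le_of_schur [SFinite μ] [SFinite ν] {k : α → β → ℝ≥0∞}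
    (hk : Measurable (Function.uncurry k)) {p q : ℝ} (hpq : p.HolderConjugate q)
    {u : α → ℝ≥0∞} (hu : Measurable u) {v : β → ℝ≥0∞} (hv : Measurable v)
    (hv_zero : ∀ᵐ s ∂ν, v s ≠ 0) (hv_top : ∀ᵐ s ∂ν, v s ≠ ∞) {A B : ℝ≥0∞}
    (hA : ∀ᵐ t ∂μ, ∫⁻ s, k t s * v s ^ q ∂ν ≤ A * u t ^ q)
    (hB : ∀ᵐ s ∂ν, ∫⁻ t, k t s * u t ^ p ∂μ ≤ B * v s ^ p) {f : β → ℝ≥0∞}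
    (hf : AEMeasurable f ν) :
    ∫⁻ t, (∫⁻ s, k t s * f s ∂ν) ^ p ∂μ ≤ A ^ (p / q) * B * ∫⁻ s, f s ^ p ∂ν := by
  set g : β → ℝ≥0∞ := fun s => (f s * (v s)⁻¹) ^ p with hg
  have hcolumn : ∀ᵐ s ∂ν, ∫⁻ t, u t ^ p * (k t s * g s) ∂μ ≤ B * f s ^ p := by
    filter_upwards [hB, hv_zero, hv_top] with s hs hs_zero hs_top
    calc ∫⁻ t, u t ^ p * (k t s * g s) ∂μ
        = ∫⁻ t, k t s * u t ^ p * g s ∂μ := lintegral_congr fun t => by ring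
      _ = (∫⁻ t, k t s * u t ^ p ∂μ) * g s :=
          lintegral_mul_const _ ((hk.comp measurable_prodMk_right).mul (hu.pow_const p))
      _ ≤ B * v s ^ p * g s := by gcongr
      _ = B * f s ^ p := by
          rw [hg, mul_assoc, ← ENNReal.mul_rpow_of_nonneg _ _ hpq.pos.le, mul_left_comm,
            ENNReal.mul_inv_cancel hs_zero hs_top, mul_one]
  have hjoint : AEMeasurable (Function.uncurry fun t s => u t ^ p * (k t s * g s)) (μ.prod ν) :=
    ((hu.comp measurable_fst).pow_const p).aemeasurable.mul
      (hk.aemeasurable.mul ((hf.mul hv.inv.aemeasurable).pow_const p).comp_snd)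
  calc ∫⁻ t, (∫⁻ s, k t s * f s ∂ν) ^ p ∂μ
      ≤ ∫⁻ t, A ^ (p / q) * ∫⁻ s, u t ^ p * (k t s * g s) ∂ν ∂μ :=
        lintegral_mono_ae (hA.mono fun t ht => rpow_lintegral_mul_le_of_le hpq
          (hk.comp measurable_prodMk_left).aemeasurable hf hv.aemeasurable hv_zero hv_top ht)
    _ = A ^ (p / q) * ∫⁻ s, ∫⁻ t, u t ^ p * (k t s * g s) ∂μ ∂ν := by
        rw [lintegral_const_mul'' (f := fun t => ∫⁻ s, u t ^ p * (k t s * g s) ∂ν) _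
          hjoint.lintegral_prod_right', lintegral_lintegral_swap hjoint]
    _ ≤ A ^ (p / q) * ∫⁻ s, B * f s ^ p ∂ν := mul_le_mul_right (lintegral_mono_ae hcolumn) _
    _ = A ^ (p / q) * B * ∫⁻ s, f s ^ p ∂ν := by
        rw [lintegral_const_mul'' _ (hf.pow_const p), mul_assoc]

theorem eLpNorm_top_le_of_kernel {k : α → β → ℝ≥0∞} (hk : ∀ t, AEMeasurable (k t) ν) {M : ℝ≥0∞}
    (hM : ∀ᵐ t ∂μ, ∫⁻ s, k t s ∂ν ≤ M) (hF : ∀ᵐ t ∂μ, ‖F t‖ₑ ≤ ∫⁻ s, k t s * ‖f s‖ₑ ∂ν) :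
    eLpNorm F ∞ μ ≤ M * eLpNorm f ∞ ν := by
  simp only [eLpNorm_exponent_top]
  refine eLpNormEssSup_le_of_ae_enorm_bound ?_
  filter_upwards [hM, hF] with t hMt hFt
  calc ‖F t‖ₑ ≤ ∫⁻ s, k t s * ‖f s‖ₑ ∂ν := hFt
    _ ≤ ∫⁻ s, k t s * eLpNormEssSup f ν ∂ν := by
        refine lintegral_mono_ae ?_
        filter_upwards [enorm_ae_le_eLpNormEssSup f ν] with s hs
        gcongr
    _ = (∫⁻ s, k t s ∂ν) * eLpNormEssSup f ν := lintegral_mul_const'' _ (hk t)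
    _ ≤ M * eLpNormEssSup f ν := by gcongr

theorem lintegral_lintegral_kernel_mul [SFinite μ] [SFinite ν] {k : α → β → ℝ≥0∞}
    (hk : Measurable (Function.uncurry k)) {g : β → ℝ≥0∞} (hg : AEMeasurable g ν) :
    ∫⁻ t, ∫⁻ s, k t s * g s ∂ν ∂μ = ∫⁻ s, (∫⁻ t, k t s ∂μ) * g s ∂ν := by
  rw [lintegral_lintegral_swap (hk.aemeasurable.mul hg.comp_snd)]
  exact lintegral_congr fun s => lintegral_mul_const _ (hk.comp measurable_prodMk_right)

theorem eLpNorm_one_le_of_kernel [SFinite μ] [SFinite ν] {k : α → β → ℝ≥0∞}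
    (hk : Measurable (Function.uncurry k)) {M : ℝ≥0∞} (hM : ∀ᵐ s ∂ν, ∫⁻ t, k t s ∂μ ≤ M)
    (hf : AEStronglyMeasurable f ν) (hF : ∀ᵐ t ∂μ, ‖F t‖ₑ ≤ ∫⁻ s, k t s * ‖f s‖ₑ ∂ν) :
    eLpNorm F 1 μ ≤ M * eLpNorm f 1 ν := by
  simp only [eLpNorm_one_eq_lintegral_enorm]
  calc ∫⁻ t, ‖F t‖ₑ ∂μ ≤ ∫⁻ t, ∫⁻ s, k t s * ‖f s‖ₑ ∂ν ∂μ := lintegral_mono_ae hF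
    _ = ∫⁻ s, (∫⁻ t, k t s ∂μ) * ‖f s‖ₑ ∂ν := lintegral_lintegral_kernel_mul hk hf.enorm
    _ ≤ ∫⁻ s, M * ‖f s‖ₑ ∂ν := lintegral_mono_ae (hM.mono fun s hs => by gcongr)
    _ = M * ∫⁻ s, ‖f s‖ₑ ∂ν := lintegral_const_mul'' _ hf.enorm

theorem eLpNorm_le_of_schur [SFinite μ] [SFinite ν] {k : α → β → ℝ≥0∞}
    (hk : Measurable (Function.uncurry k)) {p : ℝ≥0∞} {q : ℝ} (hpq : p.toReal.HolderConjugate q)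
    {u : α → ℝ≥0∞} (hu : Measurable u) {v : β → ℝ≥0∞} (hv : Measurable v)
    (hv_zero : ∀ᵐ s ∂ν, v s ≠ 0) (hv_top : ∀ᵐ s ∂ν, v s ≠ ∞) {A B : ℝ≥0∞}
    (hA : ∀ᵐ t ∂μ, ∫⁻ s, k t s * v s ^ q ∂ν ≤ A * u t ^ q)
    (hB : ∀ᵐ s ∂ν, ∫⁻ t, k t s * u t ^ p.toReal ∂μ ≤ B * v s ^ p.toReal)
    (hf : AEStronglyMeasurable f ν) (hF : ∀ᵐ t ∂μ, ‖F t‖ₑ ≤ ∫⁻ s, k t s * ‖f s‖ₑ ∂ν) :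
    eLpNorm F p μ ≤ (A ^ (p.toReal / q) * B) ^ (1 / p.toReal) * eLpNorm f p ν := by
  have hp := hpq.pos
  obtain ⟨hp_pos, hp_lt⟩ := ENNReal.toReal_pos_iff.1 hp
  rw [eLpNorm_eq_lintegral_rpow_enorm_toReal hp_pos.ne' hp_lt.ne,
    eLpNorm_eq_lintegral_rpow_enorm_toReal hp_pos.ne' hp_lt.ne,
    ← ENNReal.mul_rpow_of_nonneg _ _ (by positivity)]
  refine ENNReal.rpow_le_rpow ?_ (by positivity)
  calc ∫⁻ t, ‖F t‖ₑ ^ p.toReal ∂μ ≤ ∫⁻ t, (∫⁻ s, k t s * ‖f s‖ₑ ∂ν) ^ p.toReal ∂μ :=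
        lintegral_mono_ae (hF.mono fun t ht => ENNReal.rpow_le_rpow ht hp.le)
    _ ≤ A ^ (p.toReal / q) * B * ∫⁻ s, ‖f s‖ₑ ^ p.toReal ∂ν :=
        lintegral_rpow_lintegral_mul_le_of_schur hk hpq hu hv hv_zero hv_top hA hB hf.enorm

theorem lintegral_mul_rpow_le_of_le {k w : α → ℝ≥0∞} (hk : AEMeasurable k μ)
    (hw : AEMeasurable w μ) {M N : ℝ≥0∞} (hM : ∫⁻ s, k s ∂μ ≤ M) (hN : ∫⁻ s, k s * w s ∂μ ≤ N)
    {θ : ℝ} (hθ : θ ∈ Icc (0 : ℝ) 1) :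
    ∫⁻ s, k s * w s ^ θ ∂μ ≤ N ^ θ * M ^ (1 - θ) := by
  obtain ⟨hθ0, hθ1⟩ := hθ
  have hθ' : 0 ≤ 1 - θ := sub_nonneg.2 hθ1
  calc ∫⁻ s, k s * w s ^ θ ∂μ = ∫⁻ s, (k s * w s) ^ θ * k s ^ (1 - θ) ∂μ :=
        lintegral_congr fun s => by
          rw [ENNReal.mul_rpow_of_nonneg _ _ hθ0, mul_right_comm,
            ← ENNReal.rpow_add_of_nonneg _ _ hθ0 hθ', add_sub_cancel, ENNReal.rpow_one]
    _ ≤ (∫⁻ s, k s * w s ∂μ) ^ θ * (∫⁻ s, k s ∂μ) ^ (1 - θ) :=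
        ENNReal.lintegral_mul_norm_pow_le (hk.mul hw) hk hθ0 hθ' (add_sub_cancel _ _)
    _ ≤ N ^ θ * M ^ (1 - θ) := by gcongr

theorem rpow_schur_constants {p q r : ℝ} (hpq : p.HolderConjugate q) (hpr : p ≤ r) (hqr : q ≤ r)
    (N M : ℝ≥0∞) :
    ((N ^ (q / r) * M ^ (1 - q / r)) ^ (p / q) * (N ^ (p / r) * M ^ (1 - p / r))) ^ (1 / p)
      = N ^ (2 / r) * M ^ (1 - 2 / r) := by
  have hp := hpq.pos
  have hq := hpq.symm.pos
  have hr : 0 < r := hp.trans_le hpr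
  have hp' : 0 ≤ 1 - p / r := sub_nonneg.2 ((div_le_one hr).2 hpr)
  have hq' : 0 ≤ 1 - q / r := sub_nonneg.2 ((div_le_one hr).2 hqr)
  rw [ENNReal.mul_rpow_of_nonneg _ _ (by positivity : 0 ≤ p / q), mul_mul_mul_comm,
    ← ENNReal.rpow_mul, ← ENNReal.rpow_mul,
    ← ENNReal.rpow_add_of_nonneg _ _ (by positivity) (by positivity),
    ← ENNReal.rpow_add_of_nonneg _ _ (by positivity) hp',
    ENNReal.mul_rpow_of_nonneg _ _ (by positivity), ← ENNReal.rpow_mul, ← ENNReal.rpow_mul]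
  congr 2
  · field_simp
    norm_num
  · have := hpq.mul_eq_add
    field_simp
    linear_combination -r * this

/-- Schur's test with the weight `w ^ (1 / r)`, `r = max p q`. At `p = 1` and `p = ∞` only the bound
by `M` is left, because `2 / r = 0`. -/
theorem eLpNorm_le_of_symmetric_kernel [SFinite μ] {F : α → E} {f : α → E'} {k : α → α → ℝ≥0∞}
    (hk : Measurable (Function.uncurry k)) (hk_symm : ∀ t s, k t s = k s t) {w : α → ℝ≥0∞}
    (hw : Measurable w) (hw_zero : ∀ᵐ t ∂μ, w t ≠ 0) (hw_top : ∀ᵐ t ∂μ, w t ≠ ∞) {M N : ℝ≥0∞}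
    (hM : ∀ᵐ t ∂μ, ∫⁻ s, k t s ∂μ ≤ M) (hN : ∀ᵐ t ∂μ, ∫⁻ s, k t s * w s ∂μ ≤ N * w t)
    (p q : ℝ≥0∞) [p.HolderConjugate q] (hf : AEStronglyMeasurable f μ)
    (hF : ∀ᵐ t ∂μ, ‖F t‖ₑ ≤ ∫⁻ s, k t s * ‖f s‖ₑ ∂μ) :
    eLpNorm F p μ
      ≤ N ^ (2 / max p q).toReal * M ^ (1 - (2 / max p q).toReal) * eLpNorm f p μ := by
  have hkt : ∀ t, AEMeasurable (k t) μ := fun t => (hk.comp measurable_prodMk_left).aemeasurable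
  rcases eq_or_ne p ∞ with rfl | hp
  · simpa using eLpNorm_top_le_of_kernel hkt hM hF
  rcases eq_or_ne q ∞ with rfl | hq
  · obtain rfl := ENNReal.HolderConjugate.unique ∞ p 1
    refine (eLpNorm_one_le_of_kernel hk (M := M) ?_ hf hF).trans (by simp)
    simpa only [hk_symm] using hM
  have hpq := ENNReal.HolderConjugate.toReal_of_ne_top hp hq
  have hr : max p q ≠ ∞ := max_ne_top hp hq
  rw [ENNReal.toReal_div, ENNReal.toReal_ofNat]
  set r := (max p q).toReal
  have hpr : p.toReal ≤ r := ENNReal.toReal_mono hr (le_max_left p q)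
  have hqr : q.toReal ≤ r := ENNReal.toReal_mono hr (le_max_right p q)
  have hr_pos : 0 < r := hpq.pos.trans_le hpr
  have hschur : ∀ a, 0 < a → a ≤ r → ∀ᵐ t ∂μ, ∫⁻ s, k t s * (w s ^ (1 / r)) ^ a ∂μ
      ≤ N ^ (a / r) * M ^ (1 - a / r) * (w t ^ (1 / r)) ^ a := fun a ha har => by
    simp only [← ENNReal.rpow_mul, one_div_mul_eq_div]
    filter_upwards [hM, hN] with t hMt hNt
    refine (lintegral_mul_rpow_le_of_le (hkt t) hw.aemeasurable hMt hNt
      ⟨by positivity, (div_le_one hr_pos).2 har⟩).trans_eq ?_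
    rw [ENNReal.mul_rpow_of_nonneg _ _ (by positivity), mul_right_comm]
  rw [← rpow_schur_constants hpq hpr hqr]
  refine eLpNorm_le_of_schur hk hpq (hw.pow_const (1 / r)) (hw.pow_const (1 / r)) ?_ ?_
    (hschur _ hpq.symm.pos hqr) ?_ hf hF
  · exact hw_zero.mp (hw_top.mono fun t h_top h_zero =>
      (ENNReal.rpow_pos (pos_iff_ne_zero.2 h_zero) h_top).ne')
  · exact hw_top.mono fun t h_top => ENNReal.rpow_ne_top_of_nonneg (by positivity) h_top
  · simpa only [fun s t => hk_symm t s] using hschur _ hpq.pos hpr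

end SchurTest

section Operator

instance isFiniteMeasure_intervalMeasure : IsFiniteMeasure intervalMeasure :=
  ⟨by simp [intervalMeasure]⟩

instance neZero_intervalMeasure : NeZero intervalMeasure :=
  ⟨by simp [intervalMeasure]⟩

theorem ae_intervalMeasure {P : ℝ → Prop} (h : ∀ t ∈ Ioo (-1 : ℝ) 1, P t) :
    ∀ᵐ t ∂intervalMeasure, P t :=
  (ae_restrict_mem measurableSet_Ioo).mono h

/-- `boggioKernel n` with values in `ℝ≥0∞`, as Schur's test and Tonelli's theorem require; nothing
is lost on `[-1, 1] × [-1, 1]`, where `boggioKernel n` is nonnegative. -/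
noncomputable def ennrealKernel (n : ℕ) (t s : ℝ) : ℝ≥0∞ := ENNReal.ofReal (boggioKernel n t s)

theorem ennrealKernel_comm (n : ℕ) (t s : ℝ) : ennrealKernel n t s = ennrealKernel n s t := by
  rw [ennrealKernel, ennrealKernel, boggioKernel_comm]

theorem measurable_ennrealKernel (n : ℕ) : Measurable (Function.uncurry (ennrealKernel n)) :=
  (continuous_boggioKernel n).measurable.ennreal_ofReal

theorem integrable_boggioKernel_mul (n : ℕ) (t : ℝ) {g : ℝ → ℝ}
    (hg : Integrable g intervalMeasure) :
    Integrable (fun s => boggioKernel n t s * g s) intervalMeasure :=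
  IntegrableOn.continuousOn_mul_of_subset
    ((continuous_boggioKernel n).comp (Continuous.prodMk_right t)).continuousOn hg isCompact_Icc
    measurableSet_Ioo Ioo_subset_Icc_self

theorem lintegral_ennrealKernel_mul {n : ℕ} {t : ℝ} (ht : t ∈ Icc (-1 : ℝ) 1) {g : ℝ → ℝ}
    (hg : ∀ s ∈ Ioo (-1 : ℝ) 1, 0 ≤ g s) (hgi : Integrable g intervalMeasure) :
    ∫⁻ s, ennrealKernel n t s * ENNReal.ofReal (g s) ∂intervalMeasure
      = ENNReal.ofReal (∫ s, boggioKernel n t s * g s ∂intervalMeasure) := by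
  have hb : ∀ s ∈ Ioo (-1 : ℝ) 1, 0 ≤ boggioKernel n t s := fun s hs =>
    boggioKernel_nonneg n ht (Ioo_subset_Icc_self hs)
  rw [ofReal_integral_eq_lintegral_ofReal (integrable_boggioKernel_mul n t hgi)
    (ae_intervalMeasure fun s hs => mul_nonneg (hb s hs) (hg s hs))]
  exact lintegral_congr_ae (ae_intervalMeasure fun s hs => (ENNReal.ofReal_mul (hb s hs)).symm)

theorem lintegral_ennrealKernel {n : ℕ} (hn : 1 ≤ n) {t : ℝ} (ht : t ∈ Icc (-1 : ℝ) 1) :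
    ∫⁻ s, ennrealKernel n t s ∂intervalMeasure = ENNReal.ofReal ((1 - t ^ 2) ^ n / (2 * n)!) := by
  simpa [integral_boggioKernel hn ht] using
    lintegral_ennrealKernel_mul (n := n) ht (fun _ _ => zero_le_one) (integrable_const 1)

theorem lintegral_ennrealKernel_le {n : ℕ} (hn : 1 ≤ n) {t : ℝ} (ht : t ∈ Icc (-1 : ℝ) 1) :
    ∫⁻ s, ennrealKernel n t s ∂intervalMeasure ≤ ENNReal.ofReal (1 / (2 * n)!) := by
  rw [lintegral_ennrealKernel hn ht]
  refine ENNReal.ofReal_le_ofReal ?_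
  gcongr
  exact pow_le_one₀ (one_sub_sq_nonneg ht) (sub_le_self 1 (sq_nonneg t))

theorem one_sub_sq_pow_pos (n : ℕ) {t : ℝ} (ht : t ∈ Ioo (-1 : ℝ) 1) : 0 < (1 - t ^ 2) ^ n :=
  pow_pos (sub_pos.2 ((sq_lt_one_iff_abs_lt_one _).2 (abs_lt.2 ht))) n

theorem memLp_one_sub_sq_pow (n : ℕ) (p : ℝ≥0∞) :
    MemLp (fun t : ℝ => (1 - t ^ 2) ^ n) p intervalMeasure := by
  refine MemLp.of_bound (by fun_prop) 1 (ae_intervalMeasure fun t ht => ?_)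
  rw [Real.norm_of_nonneg (one_sub_sq_pow_pos n ht).le]
  exact pow_le_one₀ (one_sub_sq_nonneg (Ioo_subset_Icc_self ht)) (sub_le_self 1 (sq_nonneg t))

theorem lintegral_ennrealKernel_mul_one_sub_sq_pow (n : ℕ) {t : ℝ} (ht : t ∈ Icc (-1 : ℝ) 1) :
    ∫⁻ s, ennrealKernel n t s * ENNReal.ofReal ((1 - s ^ 2) ^ n) ∂intervalMeasure
      = ENNReal.ofReal (∫ s, boggioKernel n t s * (1 - s ^ 2) ^ n ∂intervalMeasure) :=
  lintegral_ennrealKernel_mul ht (fun _ hs => (one_sub_sq_pow_pos n hs).le)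
    ((memLp_one_sub_sq_pow n 1).integrable le_rfl)

theorem lintegral_ennrealKernel_mul_one_sub_sq_pow_le {n : ℕ} (hn : 1 ≤ n) {t : ℝ}
    (ht : t ∈ Ioo (-1 : ℝ) 1) :
    ∫⁻ s, ennrealKernel n t s * ENNReal.ofReal ((1 - s ^ 2) ^ n) ∂intervalMeasure
      ≤ ENNReal.ofReal (hypergeometricRatio n * greenConstant n) *
        ENNReal.ofReal ((1 - t ^ 2) ^ n) := by
  have ht' := Ioo_subset_Icc_self ht
  rw [lintegral_ennrealKernel_mul_one_sub_sq_pow n ht',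
    ← ENNReal.ofReal_mul' (one_sub_sq_pow_pos n ht).le]
  exact ENNReal.ofReal_le_ofReal (integral_boggioKernel_mul_one_sub_sq_pow_le hn ht')

theorem le_lintegral_ennrealKernel_mul_one_sub_sq_pow {n : ℕ} (hn : 1 ≤ n) {t : ℝ}
    (ht : t ∈ Ioo (-1 : ℝ) 1) :
    ENNReal.ofReal (greenConstant n) * ENNReal.ofReal ((1 - t ^ 2) ^ n)
      ≤ ∫⁻ s, ennrealKernel n t s * ENNReal.ofReal ((1 - s ^ 2) ^ n) ∂intervalMeasure := by
  have ht' := Ioo_subset_Icc_self ht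
  rw [lintegral_ennrealKernel_mul_one_sub_sq_pow n ht',
    ← ENNReal.ofReal_mul' (one_sub_sq_pow_pos n ht).le]
  exact ENNReal.ofReal_le_ofReal (le_integral_boggioKernel_mul_one_sub_sq_pow hn ht')

variable {𝕜 : Type*} [RCLike 𝕜]

theorem solutionOperator_eq {n : ℕ} (hn : 1 ≤ n) (f : ℝ → 𝕜) {t : ℝ} (ht : t ∈ Icc (-1 : ℝ) 1) :
    solutionOperator n f t = ∫ s, boggioKernel n t s • f s ∂intervalMeasure := by
  refine integral_congr_ae (ae_intervalMeasure fun s hs => ?_)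
  simp only [(isGreenFunction_greenFunction n hn).eq_boggioKernel hn ht hs,
    RCLike.real_smul_eq_coe_mul]

theorem aestronglyMeasurable_solutionOperator {n : ℕ} (hn : 1 ≤ n) {f : ℝ → 𝕜}
    (hf : AEStronglyMeasurable f intervalMeasure) :
    AEStronglyMeasurable (solutionOperator n f) intervalMeasure := by
  have h_prod : AEStronglyMeasurable (fun z : ℝ × ℝ => boggioKernel n z.1 z.2 • f z.2)
      (intervalMeasure.prod intervalMeasure) :=
    (continuous_boggioKernel n).aestronglyMeasurable.smul hf.comp_snd
  exact h_prod.integral_prod_right'.congr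
    (ae_intervalMeasure fun t ht => (solutionOperator_eq hn f (Ioo_subset_Icc_self ht)).symm)

theorem enorm_solutionOperator_le {n : ℕ} (hn : 1 ≤ n) (f : ℝ → 𝕜) {t : ℝ}
    (ht : t ∈ Icc (-1 : ℝ) 1) :
    ‖solutionOperator n f t‖ₑ ≤ ∫⁻ s, ennrealKernel n t s * ‖f s‖ₑ ∂intervalMeasure := by
  rw [solutionOperator_eq hn f ht]
  refine (enorm_integral_le_lintegral_enorm _).trans_eq
    (lintegral_congr_ae (ae_intervalMeasure fun s hs => ?_))
  simp only [enorm_smul, ennrealKernel,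
    Real.enorm_of_nonneg (boggioKernel_nonneg n ht (Ioo_subset_Icc_self hs))]

theorem enorm_solutionOperator_ofReal {n : ℕ} (hn : 1 ≤ n) {g : ℝ → ℝ}
    (hg : ∀ s ∈ Ioo (-1 : ℝ) 1, 0 ≤ g s) (hgi : Integrable g intervalMeasure) {t : ℝ}
    (ht : t ∈ Icc (-1 : ℝ) 1) :
    ‖solutionOperator n (fun s => (g s : 𝕜)) t‖ₑ
      = ∫⁻ s, ennrealKernel n t s * ENNReal.ofReal (g s) ∂intervalMeasure := by
  have h_nonneg : 0 ≤ ∫ s, boggioKernel n t s * g s ∂intervalMeasure :=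
    integral_nonneg_of_ae (ae_intervalMeasure fun s hs =>
      mul_nonneg (boggioKernel_nonneg n ht (Ioo_subset_Icc_self hs)) (hg s hs))
  simp only [solutionOperator_eq hn _ ht, RCLike.real_smul_eq_coe_mul, ← RCLike.ofReal_mul]
  rw [integral_ofReal, lintegral_ennrealKernel_mul ht hg hgi, ← ofReal_norm,
    RCLike.norm_ofReal, abs_of_nonneg h_nonneg]

theorem eLpNorm_solutionOperator_le_interpolated {n : ℕ} (hn : 1 ≤ n) (p q : ℝ≥0∞)
    [p.HolderConjugate q] {f : ℝ → 𝕜} (hf : AEStronglyMeasurable f intervalMeasure) :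
    eLpNorm (solutionOperator n f) p intervalMeasure
      ≤ ENNReal.ofReal (hypergeometricRatio n * greenConstant n) ^ (2 / max p q).toReal *
        ENNReal.ofReal (1 / (2 * n)!) ^ (1 - (2 / max p q).toReal) *
        eLpNorm f p intervalMeasure :=
  eLpNorm_le_of_symmetric_kernel (w := fun t => ENNReal.ofReal ((1 - t ^ 2) ^ n))
    (measurable_ennrealKernel n) (ennrealKernel_comm n) (by fun_prop)
    (ae_intervalMeasure fun t ht =>
      (ENNReal.ofReal_pos.2 (one_sub_sq_pow_pos n ht)).ne')
    (ae_of_all _ fun _ => ENNReal.ofReal_ne_top)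
    (ae_intervalMeasure fun _ ht => lintegral_ennrealKernel_le hn (Ioo_subset_Icc_self ht))
    (ae_intervalMeasure fun _ ht => lintegral_ennrealKernel_mul_one_sub_sq_pow_le hn ht) p q hf
    (ae_intervalMeasure fun _ ht => enorm_solutionOperator_le hn f (Ioo_subset_Icc_self ht))

theorem eLpNorm_solutionOperator_le {n : ℕ} (hn : 1 ≤ n) {p : ℝ≥0∞} (hp : 1 ≤ p) {f : ℝ → 𝕜}
    (hf : AEStronglyMeasurable f intervalMeasure) :
    eLpNorm (solutionOperator n f) p intervalMeasure
      ≤ ENNReal.ofReal (1 / (2 * n)!) * eLpNorm f p intervalMeasure := by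
  set M := ENNReal.ofReal (1 / (2 * n)!)
  have hM_zero : M ≠ 0 := (ENNReal.ofReal_pos.2 (by positivity)).ne'
  have hM : ∀ᵐ t ∂intervalMeasure, ∫⁻ s, ennrealKernel n t s ∂intervalMeasure ≤ M :=
    ae_intervalMeasure fun _ ht => lintegral_ennrealKernel_le hn (Ioo_subset_Icc_self ht)
  have := ENNReal.HolderConjugate.conjExponent hp
  refine (eLpNorm_le_of_symmetric_kernel (w := 1) (N := M) (measurable_ennrealKernel n)
    (ennrealKernel_comm n) measurable_one (ae_of_all _ fun _ => one_ne_zero)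
    (ae_of_all _ fun _ => ENNReal.one_ne_top) hM (by simpa using hM) p p.conjExponent hf
    (ae_intervalMeasure fun _ ht =>
      enorm_solutionOperator_le hn f (Ioo_subset_Icc_self ht))).trans_eq ?_
  rw [← ENNReal.rpow_add _ _ hM_zero ENNReal.ofReal_ne_top, add_sub_cancel, ENNReal.rpow_one]

theorem memLp_solutionOperator {n : ℕ} (hn : 1 ≤ n) {p : ℝ≥0∞} (hp : 1 ≤ p) {f : ℝ → 𝕜}
    (hf : MemLp f p intervalMeasure) : MemLp (solutionOperator n f) p intervalMeasure :=
  ⟨aestronglyMeasurable_solutionOperator hn hf.1,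
    (eLpNorm_solutionOperator_le hn hp hf.1).trans_lt
      (ENNReal.mul_lt_top ENNReal.ofReal_lt_top hf.2)⟩

end Operator

section OperatorNorm

variable {𝕜 : Type*} [RCLike 𝕜] {n : ℕ} {p : ℝ≥0∞}

theorem solutionOpNorm_le {C : ℝ≥0∞}
    (h : ∀ f : ℝ → 𝕜, MemLp f p intervalMeasure →
      eLpNorm (solutionOperator n f) p intervalMeasure ≤ C * eLpNorm f p intervalMeasure) :
    solutionOpNorm 𝕜 n p ≤ C :=
  iSup₂_le fun f hf => iSup_le fun hf_one => (h f hf).trans (mul_le_of_le_one_right' hf_one)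

theorem solutionOperator_const_smul (n : ℕ) (c : 𝕜) (f : ℝ → 𝕜) :
    solutionOperator n (c • f) = c • solutionOperator n f := by
  funext t
  simp only [solutionOperator, Pi.smul_apply, smul_eq_mul, mul_left_comm _ c]
  exact integral_const_mul c _

theorem eLpNorm_solutionOperator_le_solutionOpNorm_mul {f : ℝ → 𝕜} (hf : MemLp f p intervalMeasure)
    (hf_zero : eLpNorm f p intervalMeasure ≠ 0) :
    eLpNorm (solutionOperator n f) p intervalMeasure
      ≤ solutionOpNorm 𝕜 n p * eLpNorm f p intervalMeasure := by
  set N := eLpNorm f p intervalMeasure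
  have hN_pos : 0 < N.toReal := ENNReal.toReal_pos hf_zero hf.2.ne
  set c : 𝕜 := ((N.toReal⁻¹ : ℝ) : 𝕜)
  have hc : ‖c‖ₑ = N⁻¹ := by
    rw [← ofReal_norm, RCLike.norm_ofReal, abs_of_pos (inv_pos.2 hN_pos),
      ENNReal.ofReal_inv_of_pos hN_pos, ENNReal.ofReal_toReal hf.2.ne]
  have h_unit : eLpNorm (c • f) p intervalMeasure ≤ 1 := by
    rw [eLpNorm_const_smul, hc, ENNReal.inv_mul_cancel hf_zero hf.2.ne]
  have h_le : eLpNorm (solutionOperator n (c • f)) p intervalMeasure ≤ solutionOpNorm 𝕜 n p :=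
    le_iSup₂_of_le (c • f) (hf.const_smul c) (le_iSup_of_le h_unit le_rfl)
  rwa [solutionOperator_const_smul, eLpNorm_const_smul, hc, mul_comm, ← div_eq_mul_inv,
    ENNReal.div_le_iff hf_zero hf.2.ne] at h_le

variable (𝕜)

theorem le_solutionOpNorm (hn : 1 ≤ n) (hp : 1 ≤ p) {g : ℝ → ℝ}
    (hg : ∀ s ∈ Ioo (-1 : ℝ) 1, 0 ≤ g s) (hgp : MemLp g p intervalMeasure)
    (hg_zero : eLpNorm g p intervalMeasure ≠ 0) {c : ℝ≥0∞}
    (hc : c * eLpNorm g p intervalMeasure ≤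
      eLpNorm (fun t => ∫⁻ s, ennrealKernel n t s * ENNReal.ofReal (g s) ∂intervalMeasure) p
        intervalMeasure) :
    c ≤ solutionOpNorm 𝕜 n p := by
  have hg_coe : eLpNorm (fun s => (g s : 𝕜)) p intervalMeasure = eLpNorm g p intervalMeasure :=
    eLpNorm_congr_norm_ae (ae_of_all _ fun s => by rw [RCLike.norm_ofReal, Real.norm_eq_abs])
  have hT : eLpNorm (solutionOperator n fun s => (g s : 𝕜)) p intervalMeasure
      = eLpNorm (fun t => ∫⁻ s, ennrealKernel n t s * ENNReal.ofReal (g s) ∂intervalMeasure) p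
        intervalMeasure :=
    eLpNorm_congr_enorm_ae (ae_intervalMeasure fun t ht =>
      enorm_solutionOperator_ofReal hn hg (hgp.integrable hp) (Ioo_subset_Icc_self ht))
  have h_le := eLpNorm_solutionOperator_le_solutionOpNorm_mul (𝕜 := 𝕜) (n := n) hgp.ofReal
    (hg_coe ▸ hg_zero)
  rw [hT, hg_coe] at h_le
  exact (ENNReal.mul_le_mul_iff_left hg_zero hgp.2.ne).1 (hc.trans h_le)

theorem solutionOpNorm_le_inv_factorial (hn : 1 ≤ n) (hp : 1 ≤ p) :
    solutionOpNorm 𝕜 n p ≤ ENNReal.ofReal (1 / (2 * n)!) :=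
  solutionOpNorm_le fun _ hf => eLpNorm_solutionOperator_le hn hp hf.1

theorem greenConstant_le_solutionOpNorm (hn : 1 ≤ n) (hp : 1 ≤ p) :
    ENNReal.ofReal (greenConstant n) ≤ solutionOpNorm 𝕜 n p := by
  refine le_solutionOpNorm 𝕜 hn hp (fun _ hs => (one_sub_sq_pow_pos n hs).le)
    (memLp_one_sub_sq_pow n p) ?_ ?_
  · rw [Ne, eLpNorm_eq_zero_iff (memLp_one_sub_sq_pow n p).1 (zero_lt_one.trans_le hp).ne']
    intro h_zero
    obtain ⟨t, h_eq, h_pos⟩ :=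
      (h_zero.and (ae_intervalMeasure fun _ => one_sub_sq_pow_pos n)).exists
    exact h_pos.ne' h_eq
  · rw [← Real.enorm_of_nonneg (greenConstant_pos n).le, ← eLpNorm_const_smul]
    refine eLpNorm_mono_enorm_ae (ae_intervalMeasure fun t ht => ?_)
    rw [Pi.smul_apply, enorm_smul, Real.enorm_of_nonneg (greenConstant_pos n).le,
      Real.enorm_of_nonneg (one_sub_sq_pow_pos n ht).le, enorm_eq_self]
    exact le_lintegral_ennrealKernel_mul_one_sub_sq_pow hn ht

theorem exists_isOpen_lt_lintegral_ennrealKernel (hn : 1 ≤ n) {c : ℝ≥0∞}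
    (hc : c < ENNReal.ofReal (1 / (2 * n)!)) :
    ∃ U, IsOpen U ∧ intervalMeasure U ≠ 0 ∧
      ∀ t ∈ U, c < ∫⁻ s, ennrealKernel n t s ∂intervalMeasure := by
  have h_cont : Continuous fun t : ℝ => ENNReal.ofReal ((1 - t ^ 2) ^ n / (2 * n)!) :=
    ENNReal.continuous_ofReal.comp (by fun_prop)
  set U := Ioo (-1 : ℝ) 1 ∩ {t | c < ENNReal.ofReal ((1 - t ^ 2) ^ n / (2 * n)!)}
  have hU : IsOpen U := isOpen_Ioo.inter (isOpen_lt continuous_const h_cont)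
  refine ⟨U, hU, ?_, fun t ht => ?_⟩
  · rw [intervalMeasure, Measure.restrict_apply hU.measurableSet, inter_right_comm, inter_self]
    exact (hU.measure_pos volume ⟨0, by norm_num, by simpa using hc⟩).ne'
  · rw [lintegral_ennrealKernel hn (Ioo_subset_Icc_self ht.1)]
    exact ht.2

theorem inv_factorial_le_solutionOpNorm_top (hn : 1 ≤ n) :
    ENNReal.ofReal (1 / (2 * n)!) ≤ solutionOpNorm 𝕜 n ∞ := by
  refine le_of_forall_lt_imp_le_of_dense fun c hc => ?_
  obtain ⟨U, -, hU_zero, hU_lt⟩ := exists_isOpen_lt_lintegral_ennrealKernel hn hc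
  have h_one : eLpNorm (fun _ => 1 : ℝ → ℝ) ∞ intervalMeasure = 1 := by
    rw [eLpNorm_const _ ENNReal.top_ne_zero (NeZero.ne _)]
    simp
  refine le_solutionOpNorm 𝕜 hn le_top (fun _ _ => zero_le_one) (memLp_const 1)
    (h_one ▸ one_ne_zero) ?_
  simp only [h_one, ENNReal.ofReal_one, mul_one, eLpNorm_exponent_top]
  by_contra! h_lt
  refine hU_zero (measure_mono_null (t := {t | _ < ‖∫⁻ s, ennrealKernel n t s ∂intervalMeasure‖ₑ})
    (fun t ht => h_lt.trans ?_) meas_eLpNormEssSup_lt)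
  exact hU_lt t ht

theorem inv_factorial_le_solutionOpNorm_one (hn : 1 ≤ n) :
    ENNReal.ofReal (1 / (2 * n)!) ≤ solutionOpNorm 𝕜 n 1 := by
  refine le_of_forall_lt_imp_le_of_dense fun c hc => ?_
  obtain ⟨U, hU, hU_zero, hU_lt⟩ := exists_isOpen_lt_lintegral_ennrealKernel hn hc
  have h_norm : eLpNorm (U.indicator fun _ => (1 : ℝ)) 1 intervalMeasure = intervalMeasure U := by
    simp [eLpNorm_indicator_const hU.measurableSet]
  have h_ofReal : ∀ s, ENNReal.ofReal (U.indicator (fun _ => 1) s) = U.indicator (fun _ => 1) s :=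
    fun s => by by_cases hs : s ∈ U <;> simp [hs]
  refine le_solutionOpNorm 𝕜 hn le_rfl (fun s _ => indicator_nonneg (fun _ _ => zero_le_one) s)
    (memLp_indicator_const 1 hU.measurableSet 1 (.inr (measure_ne_top _ _))) (h_norm ▸ hU_zero) ?_
  simp only [h_norm, h_ofReal, eLpNorm_one_eq_lintegral_enorm, enorm_eq_self]
  rw [lintegral_lintegral_kernel_mul (measurable_ennrealKernel n)
    (measurable_const.indicator hU.measurableSet).aemeasurable,
    ← lintegral_indicator_const hU.measurableSet]
  refine lintegral_mono fun s => ?_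
  by_cases hs : s ∈ U
  · simpa only [indicator_of_mem hs, mul_one, ennrealKernel_comm n _ s] using (hU_lt s hs).le
  · simp [hs]

theorem solutionOpNorm_top (hn : 1 ≤ n) :
    solutionOpNorm 𝕜 n ∞ = ENNReal.ofReal (1 / (2 * n)!) :=
  (solutionOpNorm_le_inv_factorial 𝕜 hn le_top).antisymm (inv_factorial_le_solutionOpNorm_top 𝕜 hn)

theorem solutionOpNorm_one (hn : 1 ≤ n) :
    solutionOpNorm 𝕜 n 1 = ENNReal.ofReal (1 / (2 * n)!) :=
  (solutionOpNorm_le_inv_factorial 𝕜 hn le_rfl).antisymm (inv_factorial_le_solutionOpNorm_one 𝕜 hn)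

end OperatorNorm

section Conclusion

variable {n : ℕ}

theorem upperFactor_rpow_div (n : ℕ) (x : ℝ) :
    ENNReal.ofReal (upperFactor n ^ (2 * x) / ((2 * n)! * 2 ^ x))
      = ENNReal.ofReal (hypergeometricRatio n * greenConstant n) ^ (2 * x) *
        ENNReal.ofReal (1 / (2 * n)!) ^ (1 - 2 * x) := by
  set β := hypergeometricRatio n * greenConstant n with hβ_def
  have hβ : 0 < β :=
    mul_pos (zero_lt_one.trans_le (one_le_hypergeometricRatio n)) (greenConstant_pos n)
  have hf : (0 : ℝ) < (2 * n)! := by positivity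
  have h_upper : upperFactor n = √2 * ((2 * n)! * β) := by
    rw [upperFactor, lowerFactor_eq, hβ_def]
    ring
  have h_sqrt : √2 ^ (2 * x) = 2 ^ x := by
    rw [Real.rpow_mul (Real.sqrt_nonneg 2), Real.rpow_two, Real.sq_sqrt zero_le_two]
  rw [ENNReal.ofReal_rpow_of_pos hβ, ENNReal.ofReal_rpow_of_pos (by positivity),
    ← ENNReal.ofReal_mul (by positivity), h_upper, Real.mul_rpow (by positivity) (by positivity),
    h_sqrt, Real.mul_rpow hf.le hβ.le, one_div, Real.inv_rpow hf.le, Real.rpow_sub hf,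
    Real.rpow_one]
  congr 1
  field_simp

theorem solutionOpNorm_le_upperFactor (𝕜 : Type*) [RCLike 𝕜] (hn : 1 ≤ n) (p q : ℝ≥0∞)
    [p.HolderConjugate q] :
    solutionOpNorm 𝕜 n p ≤ ENNReal.ofReal (upperFactor n ^ (2 / max p q).toReal /
      ((2 * n)! * 2 ^ (1 / max p q).toReal)) := by
  have h_two : (2 / max p q).toReal = 2 * (1 / max p q).toReal := by
    rw [ENNReal.toReal_div, ENNReal.toReal_div, ENNReal.toReal_ofNat, ENNReal.toReal_one,
      mul_one_div]
  rw [h_two, upperFactor_rpow_div, ← h_two]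
  exact solutionOpNorm_le fun _ hf => eLpNorm_solutionOperator_le_interpolated hn p q hf.1

theorem lowerFactor_div_le_solutionOpNorm (𝕜 : Type*) [RCLike 𝕜] (hn : 1 ≤ n) {p : ℝ≥0∞}
    (hp : 1 ≤ p) :
    ENNReal.ofReal (lowerFactor n / (√2 * (2 * n)!)) ≤ solutionOpNorm 𝕜 n p := by
  rw [lowerFactor_eq, mul_div_cancel_left₀ _ (by positivity)]
  exact greenConstant_le_solutionOpNorm 𝕜 hn hp

theorem quarter_div_factorial_le_lowerFactor_div (hn : 1 ≤ n) :
    1 / 4 * (1 / ((2 * n)! : ℝ)) ≤ lowerFactor n / (√2 * (2 * n)!) := by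
  have hn' : (1 : ℝ) ≤ n := by exact_mod_cast hn
  have h_sq : (1 / 2 : ℝ) ^ 2 ≤ lowerFactor n ^ 2 :=
    le_trans (by rw [le_div_iff₀ (by positivity)]; linarith) (le_lowerFactor_sq n)
  have h_lower : 1 / 2 ≤ lowerFactor n := le_of_sq_le_sq h_sq (lowerFactor_pos n).le
  have h_sqrt : √2 ≤ 2 := Real.sqrt_le_iff.2 (by norm_num)
  calc 1 / 4 * (1 / ((2 * n)! : ℝ)) = 1 / 2 / (2 * (2 * n)!) := by ring
    _ ≤ lowerFactor n / (√2 * (2 * n)!) := by gcongr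

variable {𝕜 : Type*} [RCLike 𝕜]

theorem IsTestFunction.iteratedDeriv_eq_zero {h : ℝ → 𝕜} (hh : IsTestFunction h) {x : ℝ}
    (hx : x ∉ Ioo (-1 : ℝ) 1) (j : ℕ) : iteratedDeriv j h x = 0 := by
  have h_zero : h =ᶠ[nhds x] fun _ => 0 :=
    notMem_tsupport_iff_eventuallyEq.1 fun hx' => hx (hh.2.2 hx')
  simp [h_zero.iteratedDeriv_eq j]

theorem IsTestFunction.solutionOperator_iteratedDeriv {h : ℝ → 𝕜} (hh : IsTestFunction h)
    (hn : 1 ≤ n) {t : ℝ} (ht : t ∈ Icc (-1 : ℝ) 1) :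
    solutionOperator n (iteratedDeriv (2 * n) h) t = (-1 : ℝ) ^ n • h t := by
  rw [solutionOperator_eq hn _ ht]
  exact integral_boggioKernel_smul_iteratedDeriv hn (contDiff_infty.1 hh.1 _)
    (fun j _ => hh.iteratedDeriv_eq_zero (by simp) j)
    (fun j _ => hh.iteratedDeriv_eq_zero (by simp) j) ht

theorem IsTestFunction.factorial_mul_integral_norm_le {h : ℝ → 𝕜} (hh : IsTestFunction h)
    (hn : 1 ≤ n) :
    (2 * n)! * ∫ t, ‖h t‖ ∂intervalMeasure
      ≤ ∫ t, ‖iteratedDeriv (2 * n) h t‖ ∂intervalMeasure := by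
  have h_deriv : Continuous (iteratedDeriv (2 * n) h) :=
    (contDiff_infty.1 hh.1 _).continuous_iteratedDeriv' _
  have h_deriv_int : Integrable (iteratedDeriv (2 * n) h) intervalMeasure :=
    h_deriv.integrableOn_Icc.mono_set Ioo_subset_Icc_self
  have h_int : Integrable h intervalMeasure :=
    (hh.1.continuous.integrable_of_hasCompactSupport hh.2.1).restrict
  have h_norm : eLpNorm (solutionOperator n (iteratedDeriv (2 * n) h)) 1 intervalMeasure
      = eLpNorm h 1 intervalMeasure :=
    eLpNorm_congr_norm_ae (ae_intervalMeasure fun t ht => by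
      simp [hh.solutionOperator_iteratedDeriv hn (Ioo_subset_Icc_self ht), norm_smul])
  have h_le := eLpNorm_solutionOperator_le hn le_rfl h_deriv_int.1
  rw [h_norm, eLpNorm_one_eq_lintegral_enorm, eLpNorm_one_eq_lintegral_enorm,
    ← ofReal_integral_norm_eq_lintegral_enorm h_int,
    ← ofReal_integral_norm_eq_lintegral_enorm h_deriv_int, ← ENNReal.ofReal_mul (by positivity),
    ENNReal.ofReal_le_ofReal_iff (by positivity), one_div_mul_eq_div,
    le_div_iff₀' (by positivity)] at h_le
  exact h_le

end Conclusion

theorem mainTheorem4 (𝕜 : Type*) [RCLike 𝕜] :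
    -- `T_n` acts on every `L^p(-1,1)`
    (∀ n : ℕ, 1 ≤ n → ∀ p : ℝ≥0∞, 1 ≤ p → ∀ f : ℝ → 𝕜, MemLp f p intervalMeasure →
      MemLp (solutionOperator n f) p intervalMeasure) ∧
    -- the exact norms for `p = ∞` and `p = 1`
    (∀ n : ℕ, 1 ≤ n →
      solutionOpNorm 𝕜 n ∞ = ENNReal.ofReal (1 / (2 * n)!) ∧
      solutionOpNorm 𝕜 n 1 = ENNReal.ofReal (1 / (2 * n)!)) ∧
    -- the two-sided bound for all `p`, with factors tending to `1`
    Filter.Tendsto lowerFactor Filter.atTop (nhds 1) ∧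
    Filter.Tendsto upperFactor Filter.atTop (nhds 1) ∧
    (∀ n : ℕ, 1 ≤ n → ∀ p q r : ℝ≥0∞, 1 / p + 1 / q = 1 → r = max p q →
      ENNReal.ofReal (lowerFactor n / (√2 * (2 * n)!)) ≤ solutionOpNorm 𝕜 n p ∧
      solutionOpNorm 𝕜 n p ≤
        ENNReal.ofReal (upperFactor n ^ (2 / r).toReal / ((2 * n)! * 2 ^ (1 / r).toReal))) ∧
    -- `‖T_n‖_{p,p} ≍ 1/(2n)!`
    (∃ c C : ℝ, 0 < c ∧ 0 < C ∧ ∀ n : ℕ, 1 ≤ n → ∀ p : ℝ≥0∞, 1 ≤ p →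
      ENNReal.ofReal (c * (1 / (2 * n)!)) ≤ solutionOpNorm 𝕜 n p ∧
      solutionOpNorm 𝕜 n p ≤ ENNReal.ofReal (C * (1 / (2 * n)!))) ∧
    -- the lower bound for derivatives of test functions
    (∀ n : ℕ, 1 ≤ n → ∀ h : ℝ → 𝕜, IsTestFunction h → ∫ t, ‖h t‖ ∂intervalMeasure = 1 →
      ((2 * n)! : ℝ) ≤ ∫ t, ‖iteratedDeriv (2 * n) h t‖ ∂intervalMeasure) := by
  refine ⟨fun n hn p hp f hf => memLp_solutionOperator hn hp hf,
    fun n hn => ⟨solutionOpNorm_top 𝕜 hn, solutionOpNorm_one 𝕜 hn⟩, tendsto_lowerFactor,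
    tendsto_upperFactor, ?_, ⟨1 / 4, 1, by norm_num, one_pos, fun n hn p hp => ⟨?_, ?_⟩⟩,
    fun n hn h hh h_norm => ?_⟩
  · rintro n hn p q r hpq rfl
    have : p.HolderConjugate q := ENNReal.holderConjugate_iff.2 (by simpa only [one_div] using hpq)
    exact ⟨lowerFactor_div_le_solutionOpNorm 𝕜 hn (ENNReal.HolderConjugate.one_le p q),
      solutionOpNorm_le_upperFactor 𝕜 hn p q⟩
  · exact (ENNReal.ofReal_le_ofReal (quarter_div_factorial_le_lowerFactor_div hn)).trans
      (lowerFactor_div_le_solutionOpNorm 𝕜 hn hp)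
  · simpa only [one_mul] using solutionOpNorm_le_inv_factorial 𝕜 hn hp
  · simpa only [h_norm, mul_one] using hh.factorial_mul_integral_norm_le hn
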